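/- Setting. Let $d\ge 1$. $\mathcal G(\mathbb R^d)=\mathcal E_M(\mathbb R^d)/\mathcal N(\mathbb R^d)$ is the special Colombeau algebra: nets $(u_\varepsilon)_{\varepsilon\in(0,1]}$ of smooth functions $\mathbb R^d\to\mathbb C$ all of whose derivatives are $O(\varepsilon^{-N})$ for some $N$ uniformly on each compact set, modulo the nets all of whose derivatives are $O(\varepsilon^{m})$ for every $m$ uniformly on each compact set; $\widetilde{\mathbb C}$ denotes the ring of generalized numbers (moderate nets of complex numbers modulo negligible nets). Let $\rho$ be a Schwartz function on $\mathbb R^d$ with $\int\rho=1$ and $\int x^\beta\rho(x)\,dx=0$ for all multi-indices $\beta\neq0$, put $\rho_\varepsilon(x)=\varepsilon^{-d}\rho(x/\varepsilon)$, let $(\chi_j)_{j\in\mathbb N}$ be a locally finite smooth partition of unity on $\mathbb R^d$ with compact supports, and let $\psi_j\in\mathcal D(\mathbb R^d)$ be real-valued with $\psi_j=1$ on a neighbourhood of $\operatorname{supp}\chi_j$. The associated embedding is $\iota:\mathcal D'(\mathbb R^d)\to\mathcal G(\mathbb R^d)$, $\iota(w)=\big[\big(\sum_j\chi_j\cdot((\psi_jw)*\rho_\varepsilon)\big)_\varepsilon\big]$.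 For $\alpha\in\mathbb R$: a distribution $w\in\mathcal D'(\mathbb R^d)$ is homogeneous of degree $\alpha$ if $\langle w,\lambda^{-d}\varphi(\cdot/\lambda)\rangle=\lambda^\alpha\langle w,\varphi\rangle$ for all $\lambda>0$ and $\varphi\in\mathcal D(\mathbb R^d)$; $u\in\mathcal G(\mathbb R^d)$ is homogeneous of degree $\alpha$ if $u(\lambda x)=\lambda^\alpha u(x)$ in $\mathcal G(\mathbb R^d)$ for all $\lambda>0$; and $u$ is weakly homogeneous of degree $\alpha$ if $\int u(\lambda x)\varphi(x)\,dx=\int\lambda^\alpha u(x)\varphi(x)\,dx$ in $\widetilde{\mathbb C}$ for all $\lambda>0$ and all $\varphi\in\mathcal D(\mathbb R^d\setminus\{0\})$. Finally, $u$ is associated to $w\in\mathcal D'(\mathbb R^d)$ if $\int u_\varepsilon\varphi\,dx\to\langle w,\varphi\rangle$ as $\varepsilon\to0$ for all $\varphi\in\mathcal D(\mathbb R^d)$. Proposition. For every $d\ge1$ and every embedding $\iota$ as above: (1) Weak homogeneity does not imply homogeneity: for every $\alpha\in\mathbb R$ there is $w\in\mathcal D'(\mathbb R^d)$, homogeneous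 of degree $\alpha$, such that $\iota(w)$ is weakly homogeneous of degree $\alpha$, but $\iota(w)$ is not homogeneous (of any real degree) in $\mathcal G(\mathbb R^d)$. For $\alpha=0$ one may take $w=H\otimes\cdots\otimes H$, with $H$ the Heaviside function: it is homogeneous of degree $0$ in $\mathcal D'(\mathbb R^d)$, and $\iota(w)$ is weakly homogeneous of degree $0$ but not homogeneous of any real degree. (2) For every $\alpha\in\mathbb R$ there is $u\in\mathcal G(\mathbb R^d)$ that is weakly homogeneous of degree $\alpha$ and not associated to any distribution. For $\alpha=0$ one may take the generalized constant $u=[(a_\varepsilon)_\varepsilon]$ with $a_{1/n}=1$ for $n\in\mathbb N$ and $a_\varepsilon=0$ otherwise. -/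

import Mathlib

open Filter Topology MeasureTheory
open scoped ContDiff Distributions SchwartzMap

noncomputable section

namespace Colombeau

/-- `ℝ^d` with its Euclidean structure. -/
abbrev Space (d : ℕ) : Type := EuclideanSpace ℝ (Fin d)

/-- The parameter set `(0, 1]`. -/
abbrev Param : Type := Set.Ioc (0 : ℝ) 1

/-- The filter `ε → 0` on `(0, 1]`. -/
def toZero : Filter Param := comap (fun ε : Param => (ε : ℝ)) (𝓝 0)

/-! ### Generalized numbers -/

/-- Moderate nets of complex numbers. -/
def numModerate : Subalgebra ℂ (Param → ℂ) where
  carrier := {a | ∃ N : ℕ, ∃ C : ℝ, ∀ᶠ ε in toZero, ‖a ε‖ ≤ C * ((ε : ℝ)⁻¹) ^ N}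
  mul_mem' := by
    rintro a b ⟨N, C, h⟩ ⟨N', C', h'⟩
    refine ⟨N + N', C * C', ?_⟩
    filter_upwards [h, h'] with ε h h'
    rw [Pi.mul_apply, norm_mul, pow_add]
    calc ‖a ε‖ * ‖b ε‖ ≤ (C * ((ε : ℝ)⁻¹) ^ N) * (C' * ((ε : ℝ)⁻¹) ^ N') :=
          mul_le_mul h h' (norm_nonneg _) ((norm_nonneg _).trans h)
      _ = _ := by ring
  add_mem' := by
    rintro a b ⟨N, C, h⟩ ⟨N', C', h'⟩
    refine ⟨N + N', |C| + |C'|, ?_⟩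
    filter_upwards [h, h'] with ε h h'
    have h1 : 1 ≤ (ε : ℝ)⁻¹ := (one_le_inv₀ ε.2.1).2 ε.2.2
    have hN : ((ε : ℝ)⁻¹) ^ N ≤ ((ε : ℝ)⁻¹) ^ (N + N') := pow_le_pow_right₀ h1 (by omega)
    have hN' : ((ε : ℝ)⁻¹) ^ N' ≤ ((ε : ℝ)⁻¹) ^ (N + N') := pow_le_pow_right₀ h1 (by omega)
    have h0 : 0 ≤ (ε : ℝ)⁻¹ := zero_le_one.trans h1
    calc ‖a ε + b ε‖ ≤ ‖a ε‖ + ‖b ε‖ := norm_add_le _ _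
      _ ≤ |C| * ((ε : ℝ)⁻¹) ^ (N + N') + |C'| * ((ε : ℝ)⁻¹) ^ (N + N') :=
          add_le_add
            (h.trans (mul_le_mul (le_abs_self _) hN (pow_nonneg h0 _) (abs_nonneg _)))
            (h'.trans (mul_le_mul (le_abs_self _) hN' (pow_nonneg h0 _) (abs_nonneg _)))
      _ = _ := by ring
  algebraMap_mem' := fun c => ⟨0, ‖c‖, Eventually.of_forall fun ε => by simp⟩

/-- Negligible nets of complex numbers, an ideal in the moderate ones. -/
def numNegligible : Ideal numModerate where
  carrier := {a | ∀ m : ℕ, ∃ C : ℝ, ∀ᶠ ε in toZero, ‖(a : Param → ℂ) ε‖ ≤ C * (ε : ℝ) ^ m}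
  add_mem' := by
    intro a b h h' m
    obtain ⟨C, h⟩ := h m
    obtain ⟨C', h'⟩ := h' m
    refine ⟨C + C', ?_⟩
    filter_upwards [h, h'] with ε h h'
    calc ‖(a : Param → ℂ) ε + (b : Param → ℂ) ε‖
          ≤ ‖(a : Param → ℂ) ε‖ + ‖(b : Param → ℂ) ε‖ := norm_add_le _ _
      _ ≤ C * (ε : ℝ) ^ m + C' * (ε : ℝ) ^ m := add_le_add h h'
      _ = _ := by ring
  zero_mem' := fun m => ⟨0, Eventually.of_forall fun ε => by simp⟩
  smul_mem' := by
    intro c a h m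
    obtain ⟨N, D, hc⟩ := c.2
    obtain ⟨C, h⟩ := h (m + N)
    refine ⟨D * C, ?_⟩
    filter_upwards [h, hc] with ε h hc
    have hε : (ε : ℝ) ≠ 0 := ε.2.1.ne'
    calc ‖(c : Param → ℂ) ε * (a : Param → ℂ) ε‖
          = ‖(c : Param → ℂ) ε‖ * ‖(a : Param → ℂ) ε‖ := norm_mul _ _
      _ ≤ (D * ((ε : ℝ)⁻¹) ^ N) * (C * (ε : ℝ) ^ (m + N)) :=
          mul_le_mul hc h (norm_nonneg _) ((norm_nonneg _).trans hc)
      _ = D * C * (ε : ℝ) ^ m := by rw [pow_add, inv_pow]; field_simp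

/-- The ring of (complex) generalized numbers. -/
abbrev GenNum : Type := numModerate ⧸ numNegligible

/-- The generalized number `a` converges to (is associated to) the complex number `z`. -/
def GenNum.IsAssociated (a : GenNum) (z : ℂ) : Prop :=
  ∃ r : numModerate, Ideal.Quotient.mk numNegligible r = a ∧ Tendsto (r : Param → ℂ) toZero (𝓝 z)

/-! ### The special Colombeau algebra on `ℝ^d` -/

/-- Moderate nets of smooth functions. The bound on the Fréchet derivative of order `k` amounts to
the bounds on all partial derivatives of order `k`. -/
def moderate (d : ℕ) : Subalgebra ℂ (Param → Space d → ℂ) where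
  carrier := {u | (∀ ε, ContDiff ℝ ∞ (u ε)) ∧
    ∀ K : Set (Space d), IsCompact K → ∀ k : ℕ, ∃ N : ℕ, ∃ C : ℝ,
      ∀ᶠ ε in toZero, ∀ x ∈ K, ‖iteratedFDeriv ℝ k (u ε) x‖ ≤ C * ((ε : ℝ)⁻¹) ^ N}
  mul_mem' := by
    rintro u v ⟨hu, hu'⟩ ⟨hv, hv'⟩
    refine ⟨fun ε => (hu ε).mul (hv ε), fun K hK k => ?_⟩
    choose N C h using hu' K hK
    choose N' C' h' using hv' K hK
    refine ⟨∑ i ∈ Finset.range (k + 1), (N i + N' (k - i)),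
      ∑ i ∈ Finset.range (k + 1), (k.choose i : ℝ) * |C i| * |C' (k - i)|, ?_⟩
    have H : ∀ᶠ ε in toZero, ∀ i ∈ Finset.range (k + 1), ∀ x ∈ K,
        ‖iteratedFDeriv ℝ i (u ε) x‖ ≤ C i * ((ε : ℝ)⁻¹) ^ N i :=
      (Finset.eventually_all _).2 fun i _ => h i
    have H' : ∀ᶠ ε in toZero, ∀ i ∈ Finset.range (k + 1), ∀ x ∈ K,
        ‖iteratedFDeriv ℝ i (v ε) x‖ ≤ C' i * ((ε : ℝ)⁻¹) ^ N' i :=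
      (Finset.eventually_all _).2 fun i _ => h' i
    filter_upwards [H, H'] with ε H H' x hx
    have h1 : 1 ≤ (ε : ℝ)⁻¹ := (one_le_inv₀ ε.2.1).2 ε.2.2
    have h0 : 0 ≤ (ε : ℝ)⁻¹ := zero_le_one.trans h1
    refine (norm_iteratedFDeriv_mul_le (hu ε) (hv ε) x
      (n := k) (by exact_mod_cast le_top)).trans ?_
    rw [Finset.sum_mul]
    refine Finset.sum_le_sum fun i hi => ?_
    have hi' : k - i ∈ Finset.range (k + 1) := Finset.mem_range.2 (by omega)
    have e1 : ‖iteratedFDeriv ℝ i (u ε) x‖ ≤ |C i| * ((ε : ℝ)⁻¹) ^ N i :=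
      (H i hi x hx).trans (mul_le_mul_of_nonneg_right (le_abs_self _) (pow_nonneg h0 _))
    have e2 : ‖iteratedFDeriv ℝ (k - i) (v ε) x‖ ≤ |C' (k - i)| * ((ε : ℝ)⁻¹) ^ N' (k - i) :=
      (H' _ hi' x hx).trans (mul_le_mul_of_nonneg_right (le_abs_self _) (pow_nonneg h0 _))
    have e3 : ((ε : ℝ)⁻¹) ^ (N i + N' (k - i)) ≤
        ((ε : ℝ)⁻¹) ^ (∑ i ∈ Finset.range (k + 1), (N i + N' (k - i))) :=
      pow_le_pow_right₀ h1
        (Finset.single_le_sum (f := fun i => N i + N' (k - i)) (fun _ _ => Nat.zero_le _) hi)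
    calc (k.choose i : ℝ) * ‖iteratedFDeriv ℝ i (u ε) x‖ * ‖iteratedFDeriv ℝ (k - i) (v ε) x‖
        ≤ (k.choose i : ℝ) * (|C i| * ((ε : ℝ)⁻¹) ^ N i) *
            (|C' (k - i)| * ((ε : ℝ)⁻¹) ^ N' (k - i)) := by gcongr
      _ = (k.choose i : ℝ) * |C i| * |C' (k - i)| * ((ε : ℝ)⁻¹) ^ (N i + N' (k - i)) := by
          rw [pow_add]; ring
      _ ≤ _ := by gcongr
  add_mem' := by
    rintro u v ⟨hu, hu'⟩ ⟨hv, hv'⟩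
    refine ⟨fun ε => (hu ε).add (hv ε), fun K hK k => ?_⟩
    obtain ⟨N, C, h⟩ := hu' K hK k
    obtain ⟨N', C', h'⟩ := hv' K hK k
    refine ⟨N + N', |C| + |C'|, ?_⟩
    filter_upwards [h, h'] with ε h h' x hx
    have h1 : 1 ≤ (ε : ℝ)⁻¹ := (one_le_inv₀ ε.2.1).2 ε.2.2
    have hN : ((ε : ℝ)⁻¹) ^ N ≤ ((ε : ℝ)⁻¹) ^ (N + N') := pow_le_pow_right₀ h1 (by omega)
    have hN' : ((ε : ℝ)⁻¹) ^ N' ≤ ((ε : ℝ)⁻¹) ^ (N + N') := pow_le_pow_right₀ h1 (by omega)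
    have h0 : 0 ≤ (ε : ℝ)⁻¹ := zero_le_one.trans h1
    have hk : ((k : ℕ) : ℕ∞ω) ≤ ∞ := by exact_mod_cast le_top
    rw [Pi.add_apply, iteratedFDeriv_add_apply ((hu ε).of_le hk).contDiffAt
      ((hv ε).of_le hk).contDiffAt]
    calc ‖iteratedFDeriv ℝ k (u ε) x + iteratedFDeriv ℝ k (v ε) x‖
        ≤ ‖iteratedFDeriv ℝ k (u ε) x‖ + ‖iteratedFDeriv ℝ k (v ε) x‖ := norm_add_le _ _
      _ ≤ |C| * ((ε : ℝ)⁻¹) ^ (N + N') + |C'| * ((ε : ℝ)⁻¹) ^ (N + N') :=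
          add_le_add
            ((h x hx).trans (mul_le_mul (le_abs_self _) hN (pow_nonneg h0 _) (abs_nonneg _)))
            ((h' x hx).trans (mul_le_mul (le_abs_self _) hN' (pow_nonneg h0 _) (abs_nonneg _)))
      _ = _ := by ring
  algebraMap_mem' := by
    intro c
    refine ⟨fun ε => contDiff_const, fun K hK k => ⟨0, ‖c‖, Eventually.of_forall fun ε x hx => ?_⟩⟩
    change ‖iteratedFDeriv ℝ k (fun _ : Space d => c) x‖ ≤ _
    rcases k with _ | k
    · simp
    · rw [iteratedFDeriv_const_of_ne (by omega)]; simp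

/-- Negligible nets of smooth functions, an ideal in the moderate ones. -/
def negligible (d : ℕ) : Ideal (moderate d) where
  carrier := {u | ∀ K : Set (Space d), IsCompact K → ∀ k m : ℕ, ∃ C : ℝ,
    ∀ᶠ ε in toZero, ∀ x ∈ K,
      ‖iteratedFDeriv ℝ k ((u : Param → Space d → ℂ) ε) x‖ ≤ C * (ε : ℝ) ^ m}
  add_mem' := by
    intro u v h h' K hK k m
    obtain ⟨C, h⟩ := h K hK k m
    obtain ⟨C', h'⟩ := h' K hK k m
    refine ⟨C + C', ?_⟩
    filter_upwards [h, h'] with ε h h' x hx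
    have hk : ((k : ℕ) : ℕ∞ω) ≤ ∞ := by exact_mod_cast le_top
    change ‖iteratedFDeriv ℝ k ((u : Param → Space d → ℂ) ε + (v : Param → Space d → ℂ) ε) x‖ ≤ _
    rw [iteratedFDeriv_add_apply ((u.2.1 ε).of_le hk).contDiffAt
      ((v.2.1 ε).of_le hk).contDiffAt, add_mul]
    exact (norm_add_le _ _).trans (add_le_add (h x hx) (h' x hx))
  zero_mem' := by
    intro K hK k m
    refine ⟨0, Eventually.of_forall fun ε x hx => ?_⟩
    change ‖iteratedFDeriv ℝ k (fun _ : Space d => (0 : ℂ)) x‖ ≤ _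
    simp [iteratedFDeriv_fun_zero]
  smul_mem' := by
    intro c u h K hK k m
    choose N D hc using c.2.2 K hK
    choose C h using h K hK
    set L := ∑ i ∈ Finset.range (k + 1), N i with hL
    refine ⟨∑ i ∈ Finset.range (k + 1), (k.choose i : ℝ) * |D i| * |C (k - i) (m + L)|, ?_⟩
    have H : ∀ᶠ ε in toZero, ∀ i ∈ Finset.range (k + 1), ∀ x ∈ K,
        ‖iteratedFDeriv ℝ i ((c : Param → Space d → ℂ) ε) x‖ ≤ D i * ((ε : ℝ)⁻¹) ^ N i :=
      (Finset.eventually_all _).2 fun i _ => hc i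
    have H' : ∀ᶠ ε in toZero, ∀ i ∈ Finset.range (k + 1), ∀ x ∈ K,
        ‖iteratedFDeriv ℝ i ((u : Param → Space d → ℂ) ε) x‖ ≤ C i (m + L) * (ε : ℝ) ^ (m + L) :=
      (Finset.eventually_all _).2 fun i _ => h i _
    filter_upwards [H, H'] with ε H H' x hx
    have h1 : 1 ≤ (ε : ℝ)⁻¹ := (one_le_inv₀ ε.2.1).2 ε.2.2
    have h0 : 0 ≤ (ε : ℝ)⁻¹ := zero_le_one.trans h1
    have hε : (ε : ℝ) ≠ 0 := ε.2.1.ne'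
    have hε0 : 0 ≤ (ε : ℝ) := ε.2.1.le
    change ‖iteratedFDeriv ℝ k (fun x => (c : Param → Space d → ℂ) ε x *
      (u : Param → Space d → ℂ) ε x) x‖ ≤ _
    refine (norm_iteratedFDeriv_mul_le (c.2.1 ε) (u.2.1 ε) x
      (n := k) (by exact_mod_cast le_top)).trans ?_
    rw [Finset.sum_mul]
    refine Finset.sum_le_sum fun i hi => ?_
    have hi' : k - i ∈ Finset.range (k + 1) := Finset.mem_range.2 (by omega)
    have e3 : ((ε : ℝ)⁻¹) ^ N i ≤ ((ε : ℝ)⁻¹) ^ L :=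
      pow_le_pow_right₀ h1 (Finset.single_le_sum (fun _ _ => Nat.zero_le _) hi)
    have e1 : ‖iteratedFDeriv ℝ i ((c : Param → Space d → ℂ) ε) x‖ ≤ |D i| * ((ε : ℝ)⁻¹) ^ L :=
      (H i hi x hx).trans (mul_le_mul (le_abs_self _) e3 (pow_nonneg h0 _) (abs_nonneg _))
    have e2 : ‖iteratedFDeriv ℝ (k - i) ((u : Param → Space d → ℂ) ε) x‖ ≤
        |C (k - i) (m + L)| * (ε : ℝ) ^ (m + L) :=
      (H' _ hi' x hx).trans (mul_le_mul_of_nonneg_right (le_abs_self _) (pow_nonneg hε0 _))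
    calc (k.choose i : ℝ) * ‖iteratedFDeriv ℝ i ((c : Param → Space d → ℂ) ε) x‖ *
          ‖iteratedFDeriv ℝ (k - i) ((u : Param → Space d → ℂ) ε) x‖
        ≤ (k.choose i : ℝ) * (|D i| * ((ε : ℝ)⁻¹) ^ L) *
            (|C (k - i) (m + L)| * (ε : ℝ) ^ (m + L)) := by gcongr
      _ = _ := by rw [pow_add, inv_pow]; field_simp

/-- The special Colombeau algebra `𝒢(ℝ^d)`. -/
abbrev Gen (d : ℕ) : Type := moderate d ⧸ negligible d

/-- A generalized number, as a constant generalized function: the map induced by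
`(a_ε)_ε ↦ (x ↦ a_ε)_ε`. -/
def constMod (d : ℕ) : numModerate →ₐ[ℂ] moderate d where
  toFun a := ⟨fun ε _ => (a : Param → ℂ) ε, fun ε => contDiff_const, by
    intro K hK k
    obtain ⟨N, C, h⟩ := a.2
    refine ⟨N, C, ?_⟩
    filter_upwards [h] with ε h x hx
    rcases k with _ | k
    · simpa using h
    · rw [iteratedFDeriv_const_of_ne (by omega)]
      simpa using (norm_nonneg _).trans h⟩
  map_one' := rfl
  map_mul' _ _ := rfl
  map_zero' := rfl
  map_add' _ _ := rfl
  commutes' _ := rfl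

lemma constMod_negligible (d : ℕ) :
    numNegligible ≤ (negligible d).comap (constMod d : numModerate →ₐ[ℂ] moderate d) := by
  intro a ha K hK k m
  obtain ⟨C, h⟩ := ha m
  refine ⟨C, ?_⟩
  filter_upwards [h] with ε h x hx
  change ‖iteratedFDeriv ℝ k (fun _ : Space d => (a : Param → ℂ) ε) x‖ ≤ _
  rcases k with _ | k
  · simpa using h
  · rw [iteratedFDeriv_const_of_ne (by omega)]
    simpa using (norm_nonneg _).trans h

/-- The embedding of the generalized numbers into `𝒢(ℝ^d)` as constants. -/
def Gen.const (d : ℕ) : GenNum →ₐ[ℂ] Gen d :=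
  Ideal.quotientMapₐ (negligible d) (constMod d) (constMod_negligible d)

lemma iteratedFDeriv_scale_le {d : ℕ} {u : Space d → ℂ} (hu : ContDiff ℝ ∞ u) (c : ℝ) (k : ℕ)
    (x : Space d) : ‖iteratedFDeriv ℝ k (fun y => u (c • y)) x‖ ≤
      |c| ^ k * ‖iteratedFDeriv ℝ k u (c • x)‖ := by
  rw [iteratedFDeriv_comp_const_smul c (hu.of_le (by exact_mod_cast le_top)), norm_smul,
    norm_pow, Real.norm_eq_abs]

/-- The map `(u_ε)_ε ↦ (x ↦ u_ε(c x))_ε`. -/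
def scaleMod (d : ℕ) (c : ℝ) : moderate d →ₐ[ℂ] moderate d where
  toFun u := ⟨fun ε x => (u : Param → Space d → ℂ) ε (c • x),
    fun ε => (u.2.1 ε).comp (contDiff_const_smul c), by
      intro K hK k
      obtain ⟨N, C, h⟩ := u.2.2 ((fun x => c • x) '' K) (hK.image (continuous_const_smul c)) k
      refine ⟨N, |c| ^ k * C, ?_⟩
      filter_upwards [h] with ε h x hx
      refine (iteratedFDeriv_scale_le (u.2.1 ε) c k x).trans ?_
      rw [mul_assoc]
      exact mul_le_mul_of_nonneg_left (h _ (Set.mem_image_of_mem _ hx)) (by positivity)⟩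
  map_one' := rfl
  map_mul' _ _ := rfl
  map_zero' := rfl
  map_add' _ _ := rfl
  commutes' _ := rfl

lemma scaleMod_negligible (d : ℕ) (c : ℝ) :
    negligible d ≤ (negligible d).comap (scaleMod d c : moderate d →ₐ[ℂ] moderate d) := by
  intro u hu K hK k m
  obtain ⟨C, h⟩ := hu ((fun x => c • x) '' K) (hK.image (continuous_const_smul c)) k m
  refine ⟨|c| ^ k * C, ?_⟩
  filter_upwards [h] with ε h x hx
  refine (iteratedFDeriv_scale_le (u.2.1 ε) c k x).trans ?_
  rw [mul_assoc]
  exact mul_le_mul_of_nonneg_left (h _ (Set.mem_image_of_mem _ hx)) (by positivity)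

/-- `u(c x)`, for a generalized function `u` and a real number `c`. -/
def Gen.scale {d : ℕ} (c : ℝ) : Gen d →ₐ[ℂ] Gen d :=
  Ideal.quotientMapₐ (negligible d) (scaleMod d c) (scaleMod_negligible d c)

/-- `u` is homogeneous of degree `α`: `u(c x) = c^α u(x)` in `𝒢(ℝ^d)` for all `c > 0`. -/
def Gen.IsHomogeneous {d : ℕ} (u : Gen d) (α : ℝ) : Prop :=
  ∀ c : ℝ, 0 < c → Gen.scale c u = ((c ^ α : ℝ) : ℂ) • u

lemma integrable_mul_test {d : ℕ} {Ω : TopologicalSpace.Opens (Space d)} (φ : 𝓓(Ω, ℂ))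
    {f : Space d → ℂ} (hf : Continuous f) : Integrable (fun x => f x * φ x) :=
  (hf.mul φ.continuous).integrable_of_hasCompactSupport φ.hasCompactSupport.mul_left

lemma norm_integral_mul_test_le {d : ℕ} {Ω : TopologicalSpace.Opens (Space d)} (φ : 𝓓(Ω, ℂ))
    {f : Space d → ℂ} {B : ℝ} (hB : ∀ x ∈ tsupport φ, ‖iteratedFDeriv ℝ 0 f x‖ ≤ B) :
    ‖∫ x, f x * φ x‖ ≤ B * ∫ x, ‖φ x‖ := by
  rw [← integral_const_mul]
  refine norm_integral_le_of_norm_le ?_ (Eventually.of_forall fun x => ?_)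
  · exact ((φ.continuous.norm).integrable_of_hasCompactSupport φ.hasCompactSupport.norm).const_mul B
  · rw [norm_mul]
    by_cases hx : x ∈ tsupport φ
    · have := hB x hx
      rw [norm_iteratedFDeriv_zero] at this
      gcongr
    · simp [image_eq_zero_of_notMem_tsupport hx]

/-- The map `(u_ε)_ε ↦ (∫ u_ε φ dx)_ε`. -/
def pairMod {d : ℕ} {Ω : TopologicalSpace.Opens (Space d)} (φ : 𝓓(Ω, ℂ)) :
    moderate d →+ numModerate where
  toFun u := ⟨fun ε => ∫ x, (u : Param → Space d → ℂ) ε x * φ x, by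
    obtain ⟨N, C, h⟩ := u.2.2 (tsupport φ) φ.hasCompactSupport 0
    refine ⟨N, C * ∫ x, ‖φ x‖, ?_⟩
    filter_upwards [h] with ε h
    refine (norm_integral_mul_test_le φ h).trans (le_of_eq (by ring))⟩
  map_zero' := by ext ε; simp
  map_add' u v := by
    ext ε
    simp only [Subalgebra.coe_add, Pi.add_apply, add_mul]
    exact integral_add (integrable_mul_test φ (u.2.1 ε).continuous)
      (integrable_mul_test φ (v.2.1 ε).continuous)

/-- The integral `∫ u(x) φ(x) dx`, a generalized number. -/
def Gen.pair {d : ℕ} {Ω : TopologicalSpace.Opens (Space d)} (φ : 𝓓(Ω, ℂ)) : Gen d →+ GenNum :=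
  QuotientAddGroup.map (negligible d).toAddSubgroup numNegligible.toAddSubgroup (pairMod φ) (by
    intro u hu m
    obtain ⟨C, h⟩ := hu (tsupport φ) φ.hasCompactSupport 0 m
    refine ⟨C * ∫ x, ‖φ x‖, ?_⟩
    filter_upwards [h] with ε h
    exact (norm_integral_mul_test_le φ h).trans (le_of_eq (by ring)))

lemma Gen.pair_mk {d : ℕ} {Ω : TopologicalSpace.Opens (Space d)} (φ : 𝓓(Ω, ℂ)) (u : moderate d) :
    Gen.pair φ (Ideal.Quotient.mk _ u) = Ideal.Quotient.mk numNegligible (pairMod φ u) := rfl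

/-! ### Distributions and the embedding -/

/-- The space `𝒟'(ℝ^d)`: continuous linear functionals on the complex test functions. -/
abbrev Dist (d : ℕ) : Type := 𝓓((⊤ : TopologicalSpace.Opens (Space d)), ℂ) →L[ℂ] ℂ

/-- The test function `x ↦ c^{-d} φ(x / c)`. -/
def dilate {d : ℕ} (c : ℝ) (hc : 0 < c) (φ : 𝓓((⊤ : TopologicalSpace.Opens (Space d)), ℂ)) :
    𝓓((⊤ : TopologicalSpace.Opens (Space d)), ℂ) where
  toFun x := (((c ^ d)⁻¹ : ℝ) : ℂ) * φ (c⁻¹ • x)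
  contDiff' := contDiff_const.mul (φ.contDiff.comp (contDiff_const_smul c⁻¹))
  hasCompactSupport' :=
    (φ.hasCompactSupport.comp_homeomorph
      (Homeomorph.smulOfNeZero c⁻¹ (inv_ne_zero hc.ne'))).mul_left
  tsupport_subset' := fun _ _ => trivial

/-- `w` is homogeneous of degree `α` in `𝒟'(ℝ^d)`. -/
def Dist.IsHomogeneous {d : ℕ} (w : Dist d) (α : ℝ) : Prop :=
  ∀ (c : ℝ) (hc : 0 < c) (φ : 𝓓((⊤ : TopologicalSpace.Opens (Space d)), ℂ)),
    w (dilate c hc φ) = ((c ^ α : ℝ) : ℂ) * w φ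

/-- A Schwartz mollifier with integral one and all higher moments vanishing. -/
structure Mollifier (d : ℕ) where
  /-- the underlying Schwartz function -/
  ρ : 𝓢(Space d, ℂ)
  integral_eq_one : ∫ x, ρ x = 1
  moments : ∀ β : Fin d → ℕ, β ≠ 0 → ∫ x, (∏ i, ((x i : ℝ) : ℂ) ^ β i) * ρ x = 0

/-- A relatively compact, locally finite smooth partition of unity `χ_j` on `ℝ^d`, with cut-off
functions `ψ_j` which are equal to `1` on a neighbourhood of the support of `χ_j`. -/
structure CutoffSystem (d : ℕ) where
  /-- the partition of unity -/
  χ : ℕ → 𝓓((⊤ : TopologicalSpace.Opens (Space d)), ℝ)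
  /-- the cut-off functions -/
  ψ : ℕ → 𝓓((⊤ : TopologicalSpace.Opens (Space d)), ℝ)
  nonneg : ∀ j x, 0 ≤ χ j x
  locallyFinite : LocallyFinite fun j => Function.support (χ j)
  sum_eq_one : ∀ x, ∑ᶠ j, χ j x = 1
  cutoff : ∀ j, ∀ᶠ x in 𝓝ˢ (tsupport (χ j)), ψ j x = 1

/-- `ρ_ε(x) = ε^{-d} ρ(x / ε)`. -/
def Mollifier.scaled {d : ℕ} (ρ : Mollifier d) (ε : Param) (x : Space d) : ℂ :=
  ((((ε : ℝ) ^ d)⁻¹ : ℝ) : ℂ) * ρ.ρ ((ε : ℝ)⁻¹ • x)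

lemma Mollifier.contDiff_scaled {d : ℕ} (ρ : Mollifier d) (ε : Param) :
    ContDiff ℝ ∞ (ρ.scaled ε) :=
  contDiff_const.mul ((ρ.ρ.smooth _).comp (contDiff_const_smul _))

/-- The test function `y ↦ ψ(y) g(y)`, for a test function `ψ` and a smooth function `g`. -/
def cutTest {d : ℕ} (ψ : 𝓓((⊤ : TopologicalSpace.Opens (Space d)), ℝ)) (g : Space d → ℂ)
    (hg : ContDiff ℝ ∞ g) : 𝓓((⊤ : TopologicalSpace.Opens (Space d)), ℂ) where
  toFun y := ψ y • g y
  contDiff' := ψ.contDiff.smul hg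
  hasCompactSupport' := ψ.hasCompactSupport.smul_right
  tsupport_subset' := fun _ _ => trivial

/-- The convolution `(ψ w) * g`, that is, `x ↦ ⟨w(y), ψ(y) g(x - y)⟩`. -/
def cutConv {d : ℕ} (w : Dist d) (ψ : 𝓓((⊤ : TopologicalSpace.Opens (Space d)), ℝ))
    (g : Space d → ℂ) (hg : ContDiff ℝ ∞ g) (x : Space d) : ℂ :=
  w (cutTest ψ (fun y => g (x - y)) (hg.comp (contDiff_const.sub contDiff_id)))

/-- The net `Σ_j χ_j · ((ψ_j w) * ρ_ε)`. -/
def embedNet {d : ℕ} (ρ : Mollifier d) (P : CutoffSystem d) (w : Dist d) (ε : Param)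
    (x : Space d) : ℂ :=
  ∑ᶠ j, (P.χ j x : ℂ) * cutConv w (P.ψ j) (ρ.scaled ε) (ρ.contDiff_scaled ε) x

lemma le_inf (k : ℕ) : ((k : ℕ) : ℕ∞ω) ≤ ∞ := by exact_mod_cast le_top

/-- Continuity estimate for `f ↦ ⟨w, ψ f⟩`. -/
lemma exists_cutTest_bound {d : ℕ} (w : Dist d)
    (ψ : 𝓓((⊤ : TopologicalSpace.Opens (Space d)), ℝ)) :
    ∃ (n : ℕ) (C : ℝ), 0 ≤ C ∧ ∀ (f : Space d → ℂ) (hf : ContDiff ℝ ∞ f) (M : ℝ),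
      (∀ i ≤ n, ∀ y, ‖iteratedFDeriv ℝ i f y‖ ≤ M) → ‖w (cutTest ψ f hf)‖ ≤ C * M := by
  classical
  let K : TopologicalSpace.Compacts (Space d) := ⟨tsupport ψ, ψ.hasCompactSupport⟩
  have hK : (K : Set (Space d)) ⊆ (⊤ : TopologicalSpace.Opens (Space d)) := fun _ _ => trivial
  let T := w.comp (TestFunction.ofSupportedInCLM ℂ (n := ⊤) (F := ℂ) hK)
  obtain ⟨s, C, -, hC⟩ := Seminorm.bound_of_continuous
    (ContDiffMapSupportedIn.withSeminorms ℂ (Space d) ℂ ⊤ K)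
    ((normSeminorm ℂ ℂ).comp T.toLinearMap) (continuous_norm.comp T.continuous)
  have hb : ∀ i : ℕ, ∃ B : ℝ, ∀ x, ‖iteratedFDeriv ℝ i ψ x‖ ≤ B := fun i =>
    Continuous.bounded_above_of_compact_support
      (ψ.contDiff.continuous_iteratedFDeriv (le_inf i)) (ψ.hasCompactSupport.iteratedFDeriv i)
  choose B hB using hb
  have hB0 : ∀ i, 0 ≤ B i := fun i => (norm_nonneg _).trans (hB i 0)
  refine ⟨s.sup id, C * ∑ i ∈ s, ∑ j ∈ Finset.range (i + 1), (i.choose j : ℝ) * B j,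
    mul_nonneg C.2 (Finset.sum_nonneg fun i _ => Finset.sum_nonneg fun j _ =>
      mul_nonneg (Nat.cast_nonneg _) (hB0 j)), fun f hf M hM => ?_⟩
  have hM0 : 0 ≤ M := (norm_nonneg _).trans (hM 0 (Nat.zero_le _) 0)
  let φ : ContDiffMapSupportedIn (Space d) ℂ ⊤ K := .of_support_subset (f := fun y => ψ y • f y)
    (ψ.contDiff.smul hf)
    (fun y hy => subset_closure fun h => hy (by simp [h]))
  have hφ : w (cutTest ψ f hf) = T φ := rfl
  rw [hφ, mul_assoc]
  have h1 := hC φ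
  refine (show ‖T φ‖ ≤ _ from h1).trans ?_
  rw [smul_apply]
  refine mul_le_mul_of_nonneg_left ?_ C.2
  refine Seminorm.finset_sup_apply_le (mul_nonneg (Finset.sum_nonneg fun i _ =>
    Finset.sum_nonneg fun j _ => mul_nonneg (Nat.cast_nonneg _) (hB0 j)) hM0) fun i hi => ?_
  have hterm : ∀ x, ‖iteratedFDeriv ℝ i φ x‖ ≤
      (∑ j ∈ Finset.range (i + 1), (i.choose j : ℝ) * B j) * M := by
    intro x
    refine (norm_iteratedFDeriv_smul_le ψ.contDiff hf x (n := i) (le_inf i)).trans ?_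
    rw [Finset.sum_mul]
    refine Finset.sum_le_sum fun j hj => ?_
    have : i - j ≤ s.sup id := (Nat.sub_le i j).trans (Finset.le_sup (f := id) hi)
    exact mul_le_mul (mul_le_mul_of_nonneg_left (hB j x) (Nat.cast_nonneg _)) (hM _ this x)
      (norm_nonneg _) (mul_nonneg (Nat.cast_nonneg _) (hB0 j))
  refine ((ContDiffMapSupportedIn.seminorm_top_le_iff ℂ
    ((norm_nonneg _).trans (hterm 0)) i φ).2 fun x _ => hterm x).trans ?_
  refine mul_le_mul_of_nonneg_right ?_ hM0
  exact Finset.single_le_sum (f := fun i => ∑ j ∈ Finset.range (i + 1), (i.choose j : ℝ) * B j)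
    (fun i _ => Finset.sum_nonneg fun j _ => mul_nonneg (Nat.cast_nonneg _) (hB0 j)) hi

lemma cutTest_add {d : ℕ} (ψ : 𝓓((⊤ : TopologicalSpace.Opens (Space d)), ℝ)) {f g : Space d → ℂ}
    (hf : ContDiff ℝ ∞ f) (hg : ContDiff ℝ ∞ g) (hfg : ContDiff ℝ ∞ (fun y => f y + g y)) :
    cutTest ψ (fun y => f y + g y) hfg = cutTest ψ f hf + cutTest ψ g hg := by
  ext y; exact smul_add _ _ _

lemma cutTest_smul {d : ℕ} (ψ : 𝓓((⊤ : TopologicalSpace.Opens (Space d)), ℝ)) {f : Space d → ℂ}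
    (hf : ContDiff ℝ ∞ f) (c : ℂ) (hcf : ContDiff ℝ ∞ (fun y => c * f y)) :
    cutTest ψ (fun y => c * f y) hcf = c • cutTest ψ f hf := by
  ext y; change ψ y • (c * f y) = c * (ψ y • f y); simp only [Complex.real_smul]; ring

/-- Second order Taylor estimate for all derivatives. -/
lemma taylor_bound {E : Type} [NormedAddCommGroup E] [NormedSpace ℝ E] (k : ℕ) :
    ∀ {F : Type} [NormedAddCommGroup F] [NormedSpace ℝ F] (g : E → F) (_ : ContDiff ℝ ∞ g)
      (M : ℝ) (_ : ∀ z, ‖iteratedFDeriv ℝ (k + 2) g z‖ ≤ M) (h z : E),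
      ‖iteratedFDeriv ℝ k (fun z => g (z + h) - g z - fderiv ℝ g z h) z‖ ≤ M * ‖h‖ ^ 2 := by
  induction k with
  | zero =>
    intro F _ _ g hg M hM h z
    have hM0 : 0 ≤ M := (norm_nonneg _).trans (hM z)
    have hg' : ContDiff ℝ ∞ (fderiv ℝ g) := hg.fderiv_right (by simp)
    have hd : ∀ x, DifferentiableAt ℝ g x := fun x => hg.differentiable (by simp) x
    have hd' : ∀ x, DifferentiableAt ℝ (fderiv ℝ g) x := fun x => hg'.differentiable (by simp) x
    have h2 : ∀ x, ‖fderiv ℝ (fderiv ℝ g) x‖ ≤ M := fun x => by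
      have := hM x
      rw [← norm_iteratedFDeriv_fderiv, ← norm_iteratedFDeriv_fderiv,
        norm_iteratedFDeriv_zero] at this
      exact this
    rw [norm_iteratedFDeriv_zero]
    have key := (convex_segment z (z + h)).norm_image_sub_le_of_norm_fderiv_le' (𝕜 := ℝ) (f := g)
      (φ := fderiv ℝ g z) (C := M * ‖h‖) (x := z) (y := z + h) (fun x _ => hd x)
      (fun x hx => ?_) (left_mem_segment ℝ _ _) (right_mem_segment ℝ _ _)
    · simpa [pow_two, mul_assoc] using key
    · have h3 := convex_univ.norm_image_sub_le_of_norm_fderiv_le (𝕜 := ℝ) (f := fderiv ℝ g)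
        (C := M) (x := z) (y := x) (fun x _ => hd' x) (fun x _ => h2 x) trivial trivial
      refine h3.trans (mul_le_mul_of_nonneg_left ?_ hM0)
      have := norm_sub_le_of_mem_segment hx
      simpa using this
  | succ k ih =>
    intro F _ _ g hg M hM h z
    have hg' : ContDiff ℝ ∞ (fderiv ℝ g) := hg.fderiv_right (by simp)
    have hd : ∀ x, DifferentiableAt ℝ g x := fun x => hg.differentiable (by simp) x
    have hd' : ∀ x, DifferentiableAt ℝ (fderiv ℝ g) x := fun x => hg'.differentiable (by simp) x
    have hM' : ∀ z, ‖iteratedFDeriv ℝ (k + 2) (fderiv ℝ g) z‖ ≤ M := fun z => by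
      rw [norm_iteratedFDeriv_fderiv]; exact hM z
    rw [← norm_iteratedFDeriv_fderiv]
    have e : fderiv ℝ (fun z => g (z + h) - g z - fderiv ℝ g z h) =
        fun z => fderiv ℝ g (z + h) - fderiv ℝ g z - fderiv ℝ (fderiv ℝ g) z h := by
      funext y
      have a1 : HasFDerivAt (fun z => g (z + h)) (fderiv ℝ g (y + h)) y :=
        (hd (y + h)).hasFDerivAt.comp y ((hasFDerivAt_id y).add_const h)
      have a3 : HasFDerivAt (fun z => fderiv ℝ g z h) ((ContinuousLinearMap.apply ℝ F h).comp
          (fderiv ℝ (fderiv ℝ g) y)) y :=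
        (ContinuousLinearMap.apply ℝ F h).hasFDerivAt.comp y (hd' y).hasFDerivAt
      refine ((a1.sub (hd y).hasFDerivAt).sub a3).fderiv.trans ?_
      congr 1
      ext v
      exact second_derivative_symmetric (fun x => (hd x).hasFDerivAt) (hd' y).hasFDerivAt v h
    rw [e]
    exact ih (fderiv ℝ g) hg' M hM' h z

lemma norm_iteratedFDeriv_reflect {d : ℕ} (r : Space d → ℂ) (x y : Space d) (i : ℕ) :
    ‖iteratedFDeriv ℝ i (fun y => r (x - y)) y‖ = ‖iteratedFDeriv ℝ i r (x - y)‖ := by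
  have := (LinearIsometryEquiv.neg ℝ (E := Space d)).norm_iteratedFDeriv_comp_right
    (fun z => r (x + z)) y i
  rw [iteratedFDeriv_comp_add_left] at this
  simpa [Function.comp_def, sub_eq_add_neg] using this

lemma contDiff_dirDeriv {d : ℕ} {g : Space d → ℂ} (hg : ContDiff ℝ ∞ g) (v : Space d) :
    ContDiff ℝ ∞ (fun z => fderiv ℝ g z v) :=
  (hg.fderiv_right (by simp)).clm_apply contDiff_const

lemma norm_dirDeriv_le {d : ℕ} {g : Space d → ℂ} (hg : ContDiff ℝ ∞ g) (v z : Space d) (i : ℕ) :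
    ‖iteratedFDeriv ℝ i (fun z => fderiv ℝ g z v) z‖ ≤ ‖v‖ * ‖iteratedFDeriv ℝ (i + 1) g z‖ := by
  have hg' : ContDiff ℝ ∞ (fderiv ℝ g) := hg.fderiv_right (by simp)
  rw [← norm_iteratedFDeriv_fderiv]
  exact norm_iteratedFDeriv_clm_apply_const hg'.contDiffAt (le_inf i)

lemma hasFDerivAt_cutConv {d : ℕ} (w : Dist d) (ψ : 𝓓((⊤ : TopologicalSpace.Opens (Space d)), ℝ))
    {g : Space d → ℂ} (hg : ContDiff ℝ ∞ g) (hb : ∀ i, ∃ M, ∀ z, ‖iteratedFDeriv ℝ i g z‖ ≤ M)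
    (x : Space d) : ∃ L : Space d →L[ℝ] ℂ, HasFDerivAt (cutConv w ψ g hg) L x ∧
      ∀ v, L v = cutConv w ψ (fun z => fderiv ℝ g z v) (contDiff_dirDeriv hg v) x := by
  obtain ⟨n, C, hC, hw⟩ := exists_cutTest_bound w ψ
  let L₀ : Space d →ₗ[ℝ] ℂ :=
    { toFun := fun v => cutConv w ψ (fun z => fderiv ℝ g z v) (contDiff_dirDeriv hg v) x
      map_add' := by
        intro v v'
        unfold cutConv
        rw [← map_add]
        congr 1
        ext y
        change ψ y • fderiv ℝ g (x - y) (v + v') =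
          ψ y • fderiv ℝ g (x - y) v + ψ y • fderiv ℝ g (x - y) v'
        rw [map_add, smul_add]
      map_smul' := by
        intro c v
        unfold cutConv
        have : ∀ z : ℂ, (RingHom.id ℝ) c • z = (c : ℂ) • z := fun z => by simp
        rw [this, ← map_smul]
        congr 1
        ext y
        change ψ y • fderiv ℝ g (x - y) (c • v) = (c : ℂ) * (ψ y • fderiv ℝ g (x - y) v)
        simp only [map_smul, Complex.real_smul]
        ring }
  refine ⟨LinearMap.toContinuousLinearMap L₀, ?_, fun v => rfl⟩
  choose M hM using hb
  have hM0 : ∀ i, 0 ≤ M i := fun i => (norm_nonneg _).trans (hM i 0)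
  rw [hasFDerivAt_iff_isLittleO_nhds_zero]
  have hbig : (fun h : Space d => cutConv w ψ g hg (x + h) - cutConv w ψ g hg x -
      LinearMap.toContinuousLinearMap L₀ h) =O[𝓝 0] fun h : Space d => ‖h‖ ^ 2 := by
    refine Asymptotics.IsBigO.of_bound (C * ∑ i ∈ Finset.range (n + 1), M (i + 2))
      (Eventually.of_forall fun h => ?_)
    have hr : ContDiff ℝ ∞ (fun z => g (z + h) - g z - fderiv ℝ g z h) :=
      ((hg.comp (contDiff_id.add contDiff_const)).sub hg).sub (contDiff_dirDeriv hg h)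
    have e : cutConv w ψ g hg (x + h) - cutConv w ψ g hg x - LinearMap.toContinuousLinearMap L₀ h =
        w (cutTest ψ (fun y => (fun z => g (z + h) - g z - fderiv ℝ g z h) (x - y))
          (hr.comp (contDiff_const.sub contDiff_id))) := by
      change w _ - w _ - w _ = _
      rw [← map_sub, ← map_sub]
      congr 1
      ext y
      change ψ y • g (x + h - y) - ψ y • g (x - y) - ψ y • fderiv ℝ g (x - y) h =
        ψ y • (g (x - y + h) - g (x - y) - fderiv ℝ g (x - y) h)
      rw [smul_sub, smul_sub, show x + h - y = x - y + h by abel]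
    rw [e, norm_pow, norm_norm, mul_assoc]
    refine hw _ _ _ fun i hi y => ?_
    rw [norm_iteratedFDeriv_reflect (fun z => g (z + h) - g z - fderiv ℝ g z h)]
    refine (taylor_bound i g hg _ (hM (i + 2)) h _).trans ?_
    refine mul_le_mul_of_nonneg_right ?_ (by positivity)
    exact Finset.single_le_sum (f := fun i => M (i + 2)) (fun i _ => hM0 _)
      (Finset.mem_range.2 (by omega))
  refine hbig.trans_isLittleO ?_
  have := Asymptotics.isLittleO_norm_pow_id (E' := Space d) (n := 2) (by norm_num)
  simpa using this

lemma cutConv_aux {d : ℕ} (w : Dist d) (ψ : 𝓓((⊤ : TopologicalSpace.Opens (Space d)), ℝ))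
    {n : ℕ} {C : ℝ}
    (hw : ∀ (f : Space d → ℂ) (hf : ContDiff ℝ ∞ f) (M : ℝ),
      (∀ i ≤ n, ∀ y, ‖iteratedFDeriv ℝ i f y‖ ≤ M) → ‖w (cutTest ψ f hf)‖ ≤ C * M) (k : ℕ) :
    ∀ (g : Space d → ℂ) (hg : ContDiff ℝ ∞ g)
      (_ : ∀ i, ∃ M, ∀ z, ‖iteratedFDeriv ℝ i g z‖ ≤ M),
      ContDiff ℝ k (cutConv w ψ g hg) ∧
      ∀ M, (∀ i ≤ n + k, ∀ z, ‖iteratedFDeriv ℝ i g z‖ ≤ M) → ∀ (x : Space d)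
        (m : Fin k → Space d),
        ‖iteratedFDeriv ℝ k (cutConv w ψ g hg) x m‖ ≤ C * M * ∏ j, ‖m j‖ := by
  induction k with
  | zero =>
    intro g hg hb
    refine ⟨?_, fun M hM x m => ?_⟩
    · refine contDiff_zero.2 (continuous_iff_continuousAt.2 fun x => ?_)
      obtain ⟨L, hL, -⟩ := hasFDerivAt_cutConv w ψ hg hb x
      exact hL.continuousAt
    · simp only [iteratedFDeriv_zero_apply, Finset.univ_eq_empty, Finset.prod_empty, mul_one]
      refine hw _ _ M fun i hi y => ?_
      rw [norm_iteratedFDeriv_reflect g]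
      exact hM i (by omega) _
  | succ k ih =>
    intro g hg hb
    have hd : ∀ v, (fun x => fderiv ℝ (cutConv w ψ g hg) x v) =
        cutConv w ψ (fun z => fderiv ℝ g z v) (contDiff_dirDeriv hg v) := by
      intro v
      funext x
      obtain ⟨L, hL, hL'⟩ := hasFDerivAt_cutConv w ψ hg hb x
      rw [hL.fderiv, hL']
    have hb' : ∀ v : Space d, ∀ i, ∃ M, ∀ z,
        ‖iteratedFDeriv ℝ i (fun z => fderiv ℝ g z v) z‖ ≤ M := by
      intro v i
      obtain ⟨M, hM⟩ := hb (i + 1)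
      exact ⟨‖v‖ * M, fun z => (norm_dirDeriv_le hg v z i).trans
        (mul_le_mul_of_nonneg_left (hM z) (norm_nonneg _))⟩
    have hcd : ContDiff ℝ (k + 1 : ℕ) (cutConv w ψ g hg) := by
      push_cast
      refine contDiff_succ_iff_fderiv_apply.2 ⟨fun x => ?_, fun h => ?_, fun v => ?_⟩
      · obtain ⟨L, hL, -⟩ := hasFDerivAt_cutConv w ψ hg hb x
        exact hL.differentiableAt
      · exact absurd h (by simp)
      · rw [hd v]
        exact (ih _ _ (hb' v)).1
    refine ⟨hcd, fun M hM x m => ?_⟩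
    have e : iteratedFDeriv ℝ (k + 1) (cutConv w ψ g hg) x m =
        iteratedFDeriv ℝ k (fun y => fderiv ℝ (cutConv w ψ g hg) y (m (Fin.last k))) x
          (Fin.init m) := by
      rw [iteratedFDeriv_succ_apply_right]
      have hf : ContDiff ℝ k (fderiv ℝ (cutConv w ψ g hg)) := hcd.fderiv_right (by norm_cast)
      exact (iteratedFDeriv_clm_apply_const_apply hf le_rfl).symm
    rw [e, hd]
    refine ((ih _ _ (hb' (m (Fin.last k)))).2 (‖m (Fin.last k)‖ * M) (fun i hi z => ?_) x
      (Fin.init m)).trans (le_of_eq ?_)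
    · exact (norm_dirDeriv_le hg _ z i).trans
        (mul_le_mul_of_nonneg_left (hM _ (by omega) z) (norm_nonneg _))
    · rw [Fin.prod_univ_castSucc]
      simp only [Fin.init]
      ring

lemma norm_scaled_le {d : ℕ} (ρ : Mollifier d) (i : ℕ) : ∃ M, 0 ≤ M ∧ ∀ (ε : Param) z,
    ‖iteratedFDeriv ℝ i (ρ.scaled ε) z‖ ≤ M * ((ε : ℝ)⁻¹) ^ (d + i) := by
  obtain ⟨M, hM⟩ := ρ.ρ.decay 0 i
  refine ⟨M, hM.1.le, fun ε z => ?_⟩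
  have h0 : 0 ≤ (ε : ℝ)⁻¹ := inv_nonneg.2 ε.2.1.le
  have hs : ContDiff ℝ ∞ (fun z => ρ.ρ ((ε : ℝ)⁻¹ • z)) :=
    (ρ.ρ.smooth _).comp (contDiff_const_smul _)
  have e := iteratedFDeriv_const_smul_apply' (𝕜 := ℝ) (i := i) (x := z)
    (a := (((((ε : ℝ) ^ d)⁻¹ : ℝ) : ℂ))) (hs.of_le (le_inf i)).contDiffAt
  change ‖iteratedFDeriv ℝ i (fun z => ((((ε : ℝ) ^ d)⁻¹ : ℝ) : ℂ) • ρ.ρ ((ε : ℝ)⁻¹ • z)) z‖ ≤ _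
  rw [e, norm_smul, Complex.norm_real, Real.norm_eq_abs, abs_of_nonneg (inv_nonneg.2 (pow_nonneg ε.2.1.le d)),
    pow_add, inv_pow]
  have h2 := hM.2 ((ε : ℝ)⁻¹ • z)
  rw [pow_zero, one_mul] at h2
  calc ((ε : ℝ) ^ d)⁻¹ * ‖iteratedFDeriv ℝ i (fun z => ρ.ρ ((ε : ℝ)⁻¹ • z)) z‖
      ≤ ((ε : ℝ) ^ d)⁻¹ * (((ε : ℝ)⁻¹) ^ i * M) := by
        refine mul_le_mul_of_nonneg_left ?_ (inv_nonneg.2 (pow_nonneg ε.2.1.le d))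
        refine (iteratedFDeriv_scale_le (ρ.ρ.smooth _) _ i z).trans ?_
        rw [abs_of_nonneg h0]
        exact mul_le_mul_of_nonneg_left h2 (pow_nonneg h0 i)
    _ = _ := by ring

lemma cutConv_mem_moderate {d : ℕ} (ρ : Mollifier d) (w : Dist d)
    (ψ : 𝓓((⊤ : TopologicalSpace.Opens (Space d)), ℝ)) :
    (fun ε => cutConv w ψ (ρ.scaled ε) (ρ.contDiff_scaled ε)) ∈ moderate d := by
  obtain ⟨n, C, hC, hw⟩ := exists_cutTest_bound w ψ
  choose M hM0 hM using norm_scaled_le ρ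
  have hb : ∀ (ε : Param) i, ∃ M, ∀ z, ‖iteratedFDeriv ℝ i (ρ.scaled ε) z‖ ≤ M :=
    fun ε i => ⟨_, hM i ε⟩
  refine ⟨fun ε => contDiff_infty.2 fun k => (cutConv_aux w ψ hw k _ _ (hb ε)).1,
    fun K hK k => ⟨d + (n + k), C * ∑ i ∈ Finset.range (n + k + 1), M i,
      Eventually.of_forall fun ε x hx => ?_⟩⟩
  have h1 : 1 ≤ (ε : ℝ)⁻¹ := (one_le_inv₀ ε.2.1).2 ε.2.2
  have h0 : 0 ≤ (ε : ℝ)⁻¹ := zero_le_one.trans h1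
  have hS : 0 ≤ ∑ i ∈ Finset.range (n + k + 1), M i := Finset.sum_nonneg fun i _ => hM0 i
  refine ContinuousMultilinearMap.opNorm_le_bound (by positivity) fun m => ?_
  rw [mul_assoc C]
  refine (cutConv_aux w ψ hw k _ _ (hb ε)).2 _ (fun i hi z => ?_) x m
  refine (hM i ε z).trans (mul_le_mul ?_ (pow_le_pow_right₀ h1 (by omega)) (pow_nonneg h0 _) hS)
  exact Finset.single_le_sum (fun i _ => hM0 i) (Finset.mem_range.2 (by omega))

lemma const_mem_moderate {d : ℕ} {f : Space d → ℂ} (hf : ContDiff ℝ ∞ f) :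
    (fun _ => f) ∈ moderate d := by
  refine ⟨fun _ => hf, fun K hK k => ?_⟩
  obtain ⟨B, hB⟩ := hK.exists_bound_of_continuousOn
    (hf.continuous_iteratedFDeriv (le_inf k)).continuousOn
  exact ⟨0, B, Eventually.of_forall fun ε x hx => by simpa using hB x hx⟩

lemma embedNet_local {d : ℕ} (ρ : Mollifier d) (P : CutoffSystem d) (w : Dist d)
    {K : Set (Space d)} (hK : IsCompact K) : ∃ S : Finset ℕ, ∀ ε, ∀ x ∈ Metric.thickening 1 K,
      embedNet ρ P w ε x = (∑ j ∈ S, (fun (_ : Param) (x : Space d) => (P.χ j x : ℂ)) *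
        fun ε => cutConv w (P.ψ j) (ρ.scaled ε) (ρ.contDiff_scaled ε)) ε x := by
  have hfin := P.locallyFinite.finite_nonempty_inter_compact (hK.cthickening (r := 1))
  refine ⟨hfin.toFinset, fun ε x hx => ?_⟩
  rw [Finset.sum_apply, Finset.sum_apply]
  refine finsum_eq_sum_of_support_subset _ fun j hj => ?_
  simp only [Set.Finite.coe_toFinset, Set.mem_ofPred_eq]
  refine ⟨x, fun h => hj ?_, Metric.thickening_subset_cthickening _ _ hx⟩
  simp [h]

lemma embedNet_mem_moderate {d : ℕ} (ρ : Mollifier d) (P : CutoffSystem d) (w : Dist d) :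
    embedNet ρ P w ∈ moderate d := by
  have hS : ∀ S : Finset ℕ, (∑ j ∈ S, (fun (_ : Param) (x : Space d) => (P.χ j x : ℂ)) *
      fun ε => cutConv w (P.ψ j) (ρ.scaled ε) (ρ.contDiff_scaled ε)) ∈ moderate d := fun S =>
    Subalgebra.sum_mem _ fun j _ => Subalgebra.mul_mem _
      (const_mem_moderate (Complex.ofRealCLM.contDiff.comp (P.χ j).contDiff))
      (cutConv_mem_moderate ρ w (P.ψ j))
  refine ⟨fun ε => contDiff_iff_contDiffAt.2 fun x => ?_, fun K hK k => ?_⟩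
  · obtain ⟨S, h⟩ := embedNet_local ρ P w (isCompact_singleton (x := x))
    refine ((hS S).1 ε).contDiffAt.congr_of_eventuallyEq ?_
    filter_upwards [Metric.isOpen_thickening.mem_nhds
      (Metric.self_subset_thickening one_pos {x} rfl)] with y hy using h ε y hy
  · obtain ⟨S, h⟩ := embedNet_local ρ P w hK
    obtain ⟨N, C, hC⟩ := (hS S).2 K hK k
    refine ⟨N, C, ?_⟩
    filter_upwards [hC] with ε hC x hx
    have : embedNet ρ P w ε =ᶠ[𝓝 x] (∑ j ∈ S, (fun (_ : Param) (x : Space d) => (P.χ j x : ℂ)) *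
        fun ε => cutConv w (P.ψ j) (ρ.scaled ε) (ρ.contDiff_scaled ε)) ε := by
      filter_upwards [Metric.isOpen_thickening.mem_nhds
        (Metric.self_subset_thickening one_pos K hx)] with y hy using h ε y hy
    rw [(this.iteratedFDeriv ℝ k).eq_of_nhds]
    exact hC x hx

/-- The embedding `ι_ρ : 𝒟'(ℝ^d) → 𝒢(ℝ^d)`. -/
def embed {d : ℕ} (ρ : Mollifier d) (P : CutoffSystem d) (w : Dist d) : Gen d :=
  Ideal.Quotient.mk (negligible d) ⟨embedNet ρ P w, embedNet_mem_moderate ρ P w⟩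

/-! ### Weak homogeneity, association and the two examples -/

/-- `u` is weakly homogeneous of degree `α`: for all `c > 0` and all test functions `φ` on
`ℝ^d \ {0}`, `∫ u(c x) φ(x) dx = ∫ c^α u(x) φ(x) dx` as generalized numbers. -/
def Gen.IsWeaklyHomogeneous {d : ℕ} (u : Gen d) (α : ℝ) : Prop :=
  ∀ c : ℝ, 0 < c → ∀ φ : 𝓓((⟨{0}ᶜ, isOpen_compl_singleton⟩ : TopologicalSpace.Opens (Space d)), ℂ),
    Gen.pair φ (Gen.scale c u) = Gen.pair φ (((c ^ α : ℝ) : ℂ) • u)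

/-- `u` is associated to the distribution `w`. -/
def Gen.IsAssociated {d : ℕ} (u : Gen d) (w : Dist d) : Prop :=
  ∀ φ : 𝓓((⊤ : TopologicalSpace.Opens (Space d)), ℂ), (Gen.pair φ u).IsAssociated (w φ)

/-- The Heaviside function. -/
def heaviside (t : ℝ) : ℂ := if 0 < t then 1 else 0

lemma locallyIntegrable_heaviside (d : ℕ) :
    LocallyIntegrable (fun x : Space d => ∏ i, heaviside (x i)) := by
  refine (locallyIntegrable_const (1 : ℂ)).mono ?_ (Eventually.of_forall fun x => ?_)
  · refine (Finset.measurable_prod _ fun i _ => ?_).aestronglyMeasurable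
    exact (Measurable.ite measurableSet_Ioi measurable_const measurable_const).comp
      (by fun_prop : Measurable fun x : Space d => x i)
  · rw [norm_prod, norm_one]
    refine Finset.prod_le_one (fun i _ => norm_nonneg _) fun i _ => ?_
    unfold heaviside
    split_ifs <;> simp

/-- The distribution `H ⊗ ⋯ ⊗ H` on `ℝ^d`, that is, the regular distribution with density
`x ↦ H(x_1) ⋯ H(x_d)`. -/
def heavisideTensor (d : ℕ) : Dist d :=
  TestFunction.integralAgainstBilinCLM (ContinuousLinearMap.mul ℂ ℂ) volume
    (fun x : Space d => ∏ i, heaviside (x i))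

lemma heavisideTensor_apply (d : ℕ) (φ : 𝓓((⊤ : TopologicalSpace.Opens (Space d)), ℂ)) :
    heavisideTensor d φ = ∫ x, φ x * ∏ i, heaviside (x i) := by
  refine (TestFunction.integralAgainstBilinCLM_eq_integral ?_)
  exact (locallyIntegrable_heaviside d).locallyIntegrableOn _

open Classical in
/-- The net with `a_ε = 1` for `ε = 1/n`, `n ∈ ℕ`, and `a_ε = 0` otherwise. -/
def oscNet (ε : Param) : ℂ := if ∃ n : ℕ, (ε : ℝ) = 1 / n then 1 else 0

lemma oscNet_mem : oscNet ∈ numModerate :=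
  ⟨0, 1, Eventually.of_forall fun ε => by unfold oscNet; split_ifs <;> simp⟩

/-- The oscillating generalized number `a = [(a_ε)_ε]`. -/
def osc : GenNum := Ideal.Quotient.mk numNegligible ⟨oscNet, oscNet_mem⟩

end Colombeau

end
/-! Since all higher moments of `ρ` vanish, `∫ ι(w)_ε φ = ⟨w, φ⟩ + O(ε^m)` for every `m`. Hence
`ι(w)` and `w` have the same pairings with test functions, and `ι(w)` is weakly homogeneous as soon
as `w` is homogeneous.

If `w` is homogeneous of degree `α` and tempered, then `ε^(-α) ι(w)_ε(ε y)` tends to `(w * ρ)(y)`,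
so homogeneity of `ι(w)` forces the smooth function `w * ρ` to be homogeneous. Let `w = ∂_v^k f`
with `f(x) = ‖x‖^s H(x₁) ⋯ H(x_d)` and `v = (1, …, 1)`. The `k`-th derivative of
`F(t) = (f * ρ)(t v)` would then be homogeneous on the real line; as all derivatives of `F` decay
rapidly at `-∞`, this forces `F = 0`, whereas `t^(-s) F(t)` tends to `f(v) ≠ 0` as `t → ∞`.

For the second part, a generalized number that oscillates between `0` and `1` times a nonzero
pairing has no limit. -/

noncomputable section

namespace Colombeau

open LineDeriv

variable {d : ℕ}

section Smoothing

variable {E F : Type*} [NormedAddCommGroup E] [NormedSpace ℝ E]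
  [NormedAddCommGroup F] [NormedSpace ℝ F]

lemma norm_iteratedFDeriv_iteratedFDeriv (g : E → F) (i m : ℕ) (z : E) :
    ‖iteratedFDeriv ℝ i (iteratedFDeriv ℝ m g) z‖ = ‖iteratedFDeriv ℝ (i + m) g z‖ := by
  induction m generalizing i with
  | zero => rw [iteratedFDeriv_zero_eq_comp, LinearIsometryEquiv.norm_iteratedFDeriv_comp_left,
      add_zero]
  | succ m ih =>
    have fderiv_eq : fderiv ℝ (iteratedFDeriv ℝ m g) =
        continuousMultilinearCurryLeftEquiv ℝ (fun _ : Fin (m + 1) => E) F ∘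
          iteratedFDeriv ℝ (m + 1) g := fderiv_iteratedFDeriv
    rw [← add_assoc, add_right_comm, ← ih (i + 1), ← norm_iteratedFDeriv_fderiv, fderiv_eq,
      LinearIsometryEquiv.norm_iteratedFDeriv_comp_left]

/-- `g` is smooth and each of its derivatives is bounded on the whole space. -/
structure HasBoundedDerivs (g : E → F) : Prop where
  contDiff : ContDiff ℝ ∞ g
  bounded : ∀ i, ∃ M, ∀ z, ‖iteratedFDeriv ℝ i g z‖ ≤ M

namespace HasBoundedDerivs

lemma fderiv {g : E → F} (hg : HasBoundedDerivs g) : HasBoundedDerivs (fderiv ℝ g) := by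
  refine ⟨hg.contDiff.fderiv_right (by simp), fun i => ?_⟩
  obtain ⟨M, hM⟩ := hg.bounded (i + 1)
  exact ⟨M, fun z => by rw [norm_iteratedFDeriv_fderiv]; exact hM z⟩

lemma iteratedFDeriv {g : E → F} (hg : HasBoundedDerivs g) (m : ℕ) :
    HasBoundedDerivs (iteratedFDeriv ℝ m g) := by
  refine ⟨hg.contDiff.iteratedFDeriv_right (by exact_mod_cast le_top), fun i => ?_⟩
  obtain ⟨M, hM⟩ := hg.bounded (i + m)
  exact ⟨M, fun z => by rw [norm_iteratedFDeriv_iteratedFDeriv]; exact hM z⟩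

lemma exists_norm_le {g : E → F} (hg : HasBoundedDerivs g) : ∃ M, ∀ z, ‖g z‖ ≤ M := by
  obtain ⟨M, hM⟩ := hg.bounded 0
  exact ⟨M, fun z => by simpa using hM z⟩

lemma of_hasCompactSupport {g : E → F} (hg : ContDiff ℝ ∞ g) (hc : HasCompactSupport g) :
    HasBoundedDerivs g :=
  ⟨hg, fun i => Continuous.bounded_above_of_compact_support
    (hg.continuous_iteratedFDeriv (le_inf i)) (hc.iteratedFDeriv i)⟩

end HasBoundedDerivs

lemma norm_taylor_remainder_le [CompleteSpace F] {g : E → F} {n : ℕ} (hg : ContDiff ℝ (n + 1) g)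
    {M : ℝ} (hM : ∀ z, ‖iteratedFDeriv ℝ (n + 1) g z‖ ≤ M) (x h : E) :
    ‖g (x + h) - ∑ k ∈ Finset.range (n + 1),
      (k.factorial : ℝ)⁻¹ • iteratedFDeriv ℝ k g x (fun _ => h)‖ ≤ M * ‖h‖ ^ (n + 1) := by
  have integrand_le : ∀ t ∈ Set.uIoc (0 : ℝ) 1,
      ‖(1 - t) ^ n • iteratedFDeriv ℝ (n + 1) g (x + t • h) (fun _ => h)‖ ≤
        M * ‖h‖ ^ (n + 1) := by
    intro t ht
    rw [Set.uIoc_of_le zero_le_one] at ht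
    have pow_le : (1 - t) ^ n ≤ 1 := pow_le_one₀ (by linarith [ht.2]) (by linarith [ht.1])
    have apply_le : ‖iteratedFDeriv ℝ (n + 1) g (x + t • h) (fun _ => h)‖ ≤ M * ‖h‖ ^ (n + 1) := by
      refine ((iteratedFDeriv ℝ (n + 1) g (x + t • h)).le_opNorm _).trans ?_
      rw [Finset.prod_const, Finset.card_fin]
      exact mul_le_mul_of_nonneg_right (hM _) (by positivity)
    rw [norm_smul, norm_pow, Real.norm_of_nonneg (by linarith [ht.2])]
    simpa using mul_le_mul pow_le apply_le (norm_nonneg _) zero_le_one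
  have integral_le := intervalIntegral.norm_integral_le_of_norm_le_const integrand_le
  rw [sub_zero, abs_one, mul_one] at integral_le
  have factorial_le : ‖((n.factorial : ℝ))⁻¹‖ ≤ 1 := by
    rw [norm_inv, Real.norm_natCast]
    exact inv_le_one_of_one_le₀ (by exact_mod_cast n.factorial_pos)
  rw [map_add_eq_sum_add_integral_iteratedFDeriv (fun t _ => hg.contDiffAt),
    add_sub_cancel_left, norm_smul]
  simpa using mul_le_mul factorial_le integral_le (norm_nonneg _) zero_le_one

variable [MeasureSpace E] [OpensMeasurableSpace E] [SecondCountableTopology E] [NormedSpace ℂ F]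

/-- The average `y ↦ ∫ κ(t) g(y + t) dt` of the translates of `g`, weighted by the kernel `κ`. It
is the convolution of `g` with the reflected kernel `t ↦ κ(-t)`. -/
def smoothing (κ : E → ℂ) (g : E → F) (y : E) : F := ∫ t, κ t • g (y + t)

lemma integrable_smul_translate {κ : E → ℂ} (hκ : Integrable κ) {g : E → F}
    (hg : HasBoundedDerivs g) (y : E) : Integrable fun t => κ t • g (y + t) := by
  obtain ⟨M, hM⟩ := hg.exists_norm_le
  exact hκ.smul_bdd M (hg.contDiff.continuous.comp (continuous_const_add y)).aestronglyMeasurable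
    (Eventually.of_forall fun t => hM _)

variable [IsScalarTower ℝ ℂ F]

lemma hasFDerivAt_smoothing {κ : E → ℂ} (hκ : Integrable κ) {g : E → F}
    (hg : HasBoundedDerivs g) (y : E) :
    HasFDerivAt (smoothing κ g) (smoothing κ (fderiv ℝ g) y) y := by
  obtain ⟨M, hM⟩ := hg.fderiv.exists_norm_le
  refine hasFDerivAt_integral_of_dominated_of_fderiv_le (𝕜 := ℝ) (s := Set.univ)
    (F' := fun y t => κ t • fderiv ℝ g (y + t)) (bound := fun t => ‖κ t‖ * M) univ_mem
    (Eventually.of_forall fun y => (integrable_smul_translate hκ hg y).aestronglyMeasurable)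
    (integrable_smul_translate hκ hg y)
    (integrable_smul_translate hκ hg.fderiv y).aestronglyMeasurable
    (Eventually.of_forall fun t x _ => ?_) (hκ.norm.mul_const M)
    (Eventually.of_forall fun t x _ => ?_)
  · rw [norm_smul]
    exact mul_le_mul_of_nonneg_left (hM _) (norm_nonneg _)
  · have h : HasFDerivAt (fun x => g (x + t)) (fderiv ℝ g (x + t)) x :=
      (hg.contDiff.differentiable (by simp) (x + t)).hasFDerivAt.comp x
        ((hasFDerivAt_id x).add_const t)
    exact h.const_smul (κ t)

lemma hasFTaylorSeriesUpTo_smoothing [CompleteSpace F] {κ : E → ℂ} (hκ : Integrable κ) {g : E → F}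
    (hg : HasBoundedDerivs g) :
    HasFTaylorSeriesUpTo ∞ (smoothing κ g) fun y m => smoothing κ (iteratedFDeriv ℝ m g) y where
  zero_eq y := (ContinuousMultilinearMap.apply ℝ (fun _ : Fin 0 => E) F 0).integral_comp_comm
    (integrable_smul_translate hκ (hg.iteratedFDeriv 0) y) |>.symm
  fderiv m _ y := by
    convert! hasFDerivAt_smoothing hκ (hg.iteratedFDeriv m) y using 1
    ext v w
    rw [smoothing, smoothing, ContinuousMultilinearMap.curryLeft_apply,
      ContinuousMultilinearMap.integral_apply
        (integrable_smul_translate hκ (hg.iteratedFDeriv (m + 1)) y),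
      ContinuousLinearMap.integral_apply
        (integrable_smul_translate hκ (hg.iteratedFDeriv m).fderiv y),
      ContinuousMultilinearMap.integral_apply
        ((integrable_smul_translate hκ (hg.iteratedFDeriv m).fderiv y).apply_continuousLinearMap v)]
    rfl
  cont m _ := continuous_iff_continuousAt.2 fun y =>
    (hasFDerivAt_smoothing hκ (hg.iteratedFDeriv m) y).continuousAt

lemma contDiff_smoothing [CompleteSpace F] {κ : E → ℂ} (hκ : Integrable κ) {g : E → F}
    (hg : HasBoundedDerivs g) : ContDiff ℝ ∞ (smoothing κ g) :=
  (hasFTaylorSeriesUpTo_smoothing hκ hg).contDiff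

lemma iteratedFDeriv_smoothing [CompleteSpace F] {κ : E → ℂ} (hκ : Integrable κ) {g : E → F}
    (hg : HasBoundedDerivs g) (m : ℕ) :
    iteratedFDeriv ℝ m (smoothing κ g) = smoothing κ (iteratedFDeriv ℝ m g) :=
  funext fun y => ((hasFTaylorSeriesUpTo_smoothing hκ hg).eq_iteratedFDeriv (le_inf m) y).symm

end Smoothing

section MollificationRate

variable {F : Type*} [NormedAddCommGroup F] [NormedSpace ℝ F]

lemma multilinear_diag_eq_sum {j : ℕ} (T : Space d [×j]→L[ℝ] F) (t : Space d) :
    T (fun _ => t) = ∑ σ : Fin j → Fin d,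
      (∏ a, t (σ a)) • T fun a => EuclideanSpace.single (σ a) (1 : ℝ) := by
  have ht : t = ∑ i, t i • EuclideanSpace.single i (1 : ℝ) := by
    simpa using ((EuclideanSpace.basisFun (Fin d) ℝ).sum_repr t).symm
  conv_lhs => rw [ht, T.map_sum (fun _ i => t i • EuclideanSpace.single i (1 : ℝ))]
  exact Finset.sum_congr rfl fun σ _ => T.map_smul_univ _ _

lemma prod_comp_eq_prod_pow_card {ι κ M : Type*} [Fintype ι] [Fintype κ] [DecidableEq κ]
    [CommMonoid M] (f : κ → M) (σ : ι → κ) :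
    ∏ a, f (σ a) = ∏ i, f i ^ (Finset.univ.filter fun a => σ a = i).card := by
  simp_rw [← Finset.prod_const, Finset.prod_fiberwise_of_maps_to' fun a _ => Finset.mem_univ (σ a)]

lemma integrable_monomial_mul (r : 𝓢(Space d, ℂ)) (β : Fin d → ℕ) :
    Integrable fun t : Space d => (∏ i, ((t i : ℝ) : ℂ) ^ β i) * r t := by
  refine (r.integrable_pow_mul volume (∑ i, β i)).mono'
    (Continuous.aestronglyMeasurable (by fun_prop)) (Eventually.of_forall fun t => ?_)
  rw [norm_mul, norm_prod, ← Finset.prod_pow_eq_pow_sum]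
  refine mul_le_mul_of_nonneg_right ?_ (norm_nonneg _)
  refine Finset.prod_le_prod (fun i _ => norm_nonneg _) fun i _ => ?_
  rw [norm_pow, Complex.norm_real]
  exact pow_le_pow_left₀ (norm_nonneg _) (PiLp.norm_apply_le t i) _

lemma smul_multilinear_diag_smul {j : ℕ} (T : Space d [×j]→L[ℝ] F) (a c : ℝ) (t : Space d) :
    (a • T fun _ => c • t) = ((a * c ^ j) • T) fun _ => t := by
  rw [T.map_smul_univ (fun _ => c) (fun _ => t), Finset.prod_const, Finset.card_fin, smul_smul]
  rfl

variable [NormedSpace ℂ F] [IsScalarTower ℝ ℂ F]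

lemma smul_multilinear_diag_eq_sum (c : ℂ) {j : ℕ} (T : Space d [×j]→L[ℝ] F) (t : Space d) :
    c • T (fun _ => t) = ∑ σ : Fin j → Fin d,
      ((∏ i, ((t i : ℝ) : ℂ) ^ (Finset.univ.filter fun a => σ a = i).card) * c) •
        T fun a => EuclideanSpace.single (σ a) (1 : ℝ) := by
  rw [multilinear_diag_eq_sum, Finset.smul_sum]
  refine Finset.sum_congr rfl fun σ _ => ?_
  rw [← prod_comp_eq_prod_pow_card (fun i => ((t i : ℝ) : ℂ)), mul_comm, mul_smul,
    ← algebraMap_smul ℂ (∏ a, t (σ a)), Complex.coe_algebraMap, Complex.ofReal_prod]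

lemma integrable_smul_multilinear_diag (r : 𝓢(Space d, ℂ)) {j : ℕ} (T : Space d [×j]→L[ℝ] F) :
    Integrable fun t => r t • T fun _ => t := by
  simp only [smul_multilinear_diag_eq_sum]
  exact integrable_finsetSum _ fun σ _ => (integrable_monomial_mul r _).smul_const _

lemma Mollifier.integral_smul_multilinear_diag_eq_zero [CompleteSpace F] (ρ : Mollifier d)
    {j : ℕ} (hj : j ≠ 0) (T : Space d [×j]→L[ℝ] F) : ∫ t, ρ.ρ t • T (fun _ => t) = 0 := by
  simp only [smul_multilinear_diag_eq_sum]
  rw [integral_finsetSum _ fun σ _ => (integrable_monomial_mul ρ.ρ _).smul_const _]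
  refine Finset.sum_eq_zero fun σ _ => ?_
  rw [integral_smul_const, ρ.moments, zero_smul]
  intro card_fibre_eq_zero
  have := congr_fun card_fibre_eq_zero (σ ⟨0, Nat.pos_of_ne_zero hj⟩)
  simp only [Pi.zero_apply, Finset.card_eq_zero, Finset.filter_eq_empty_iff] at this
  exact this (Finset.mem_univ _) rfl

lemma integrable_smul_taylor (r : 𝓢(Space d, ℂ)) (g : Space d → F) (y : Space d) (c : ℝ) (n : ℕ) :
    Integrable fun t => r t • ∑ k ∈ Finset.range n,
      (k.factorial : ℝ)⁻¹ • iteratedFDeriv ℝ k g y (fun _ => c • t) := by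
  simp only [smul_multilinear_diag_smul, Finset.smul_sum]
  exact integrable_finsetSum _ fun k _ => integrable_smul_multilinear_diag r _

lemma Mollifier.integral_smul_taylor [CompleteSpace F] (ρ : Mollifier d) (g : Space d → F)
    (y : Space d) (c : ℝ) (n : ℕ) :
    ∫ t, ρ.ρ t • ∑ k ∈ Finset.range (n + 1),
      (k.factorial : ℝ)⁻¹ • iteratedFDeriv ℝ k g y (fun _ => c • t) = g y := by
  simp only [smul_multilinear_diag_smul, Finset.smul_sum]
  rw [integral_finsetSum _ fun k _ => integrable_smul_multilinear_diag ρ.ρ _,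
    Finset.sum_range_succ', Finset.sum_eq_zero fun k _ =>
      ρ.integral_smul_multilinear_diag_eq_zero k.succ_ne_zero _, zero_add]
  simp [integral_smul_const, ρ.integral_eq_one]

lemma Mollifier.integrable_scaled (ρ : Mollifier d) (ε : Param) : Integrable (ρ.scaled ε) :=
  (ρ.ρ.integrable.comp_smul (inv_ne_zero ε.2.1.ne')).const_mul _

lemma Mollifier.smoothing_scaled (ρ : Mollifier d) (ε : Param) (g : Space d → F) (y : Space d) :
    smoothing (ρ.scaled ε) g y = ∫ t, ρ.ρ t • g (y + (ε : ℝ) • t) := by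
  have hε : (ε : ℝ) ≠ 0 := ε.2.1.ne'
  have := Measure.integral_comp_inv_smul (μ := (volume : Measure (Space d)))
    (fun t => ρ.ρ t • g (y + (ε : ℝ) • t)) (ε : ℝ)
  rw [finrank_euclideanSpace_fin, abs_of_nonneg (pow_nonneg ε.2.1.le d)] at this
  rw [← inv_smul_smul₀ (pow_ne_zero d hε) (∫ t, ρ.ρ t • g (y + (ε : ℝ) • t)), ← this,
    ← integral_smul]
  refine integral_congr_ae (Eventually.of_forall fun t => ?_)
  simp only [smul_inv_smul₀ hε, Mollifier.scaled, mul_smul]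
  rw [← algebraMap_smul ℂ ((ε : ℝ) ^ d)⁻¹]
  rfl

/- By the moment conditions, `ρ` integrates the Taylor polynomial of `g` at `y` to `g y`, so only
the remainder contributes. -/
lemma norm_smoothing_scaled_sub_le [CompleteSpace F] (ρ : Mollifier d) {g : Space d → F}
    (hg : HasBoundedDerivs g) (n : ℕ) :
    ∃ C, ∀ (ε : Param) y, ‖smoothing (ρ.scaled ε) g y - g y‖ ≤ C * (ε : ℝ) ^ n := by
  obtain ⟨M, hM⟩ := hg.bounded (n + 1)
  refine ⟨∫ t, M * (‖t‖ ^ (n + 1) * ‖ρ.ρ t‖), fun ε y => ?_⟩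
  have integrable_g : Integrable fun t => ρ.ρ t • g (y + (ε : ℝ) • t) := by
    obtain ⟨B, hB⟩ := hg.exists_norm_le
    exact ρ.ρ.integrable.smul_bdd B (hg.contDiff.continuous.comp
      (by fun_prop : Continuous fun t : Space d => y + (ε : ℝ) • t)).aestronglyMeasurable
      (Eventually.of_forall fun t => hB _)
  rw [ρ.smoothing_scaled, ← ρ.integral_smul_taylor g y ε n,
    ← integral_sub integrable_g (integrable_smul_taylor ρ.ρ g y ε _), ← integral_mul_const]
  refine norm_integral_le_of_norm_le
    (((ρ.ρ.integrable_pow_mul volume (n + 1)).const_mul M).mul_const _)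
    (Eventually.of_forall fun t => ?_)
  rw [← smul_sub, norm_smul]
  have remainder_le := norm_taylor_remainder_le
    (hg.contDiff.of_le (le_inf (n + 1))) hM y ((ε : ℝ) • t)
  rw [norm_smul, Real.norm_of_nonneg ε.2.1.le, mul_pow] at remainder_le
  have hM0 : 0 ≤ M := (norm_nonneg _).trans (hM 0)
  have hε : (ε : ℝ) ^ (n + 1) ≤ (ε : ℝ) ^ n :=
    pow_le_pow_of_le_one ε.2.1.le ε.2.2 (Nat.le_succ n)
  calc ‖ρ.ρ t‖ * _ ≤ ‖ρ.ρ t‖ * (M * ((ε : ℝ) ^ n * ‖t‖ ^ (n + 1))) := by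
        refine mul_le_mul_of_nonneg_left (remainder_le.trans ?_) (norm_nonneg _)
        gcongr
    _ = _ := by ring

lemma norm_iteratedFDeriv_smoothing_scaled_sub_le [CompleteSpace F] (ρ : Mollifier d)
    {g : Space d → F} (hg : HasBoundedDerivs g) (n i : ℕ) :
    ∃ C, ∀ (ε : Param) y,
      ‖iteratedFDeriv ℝ i (fun y => smoothing (ρ.scaled ε) g y - g y) y‖ ≤ C * (ε : ℝ) ^ n := by
  obtain ⟨C, hC⟩ := norm_smoothing_scaled_sub_le ρ (hg.iteratedFDeriv i) n
  refine ⟨C, fun ε y => ?_⟩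
  have hs := contDiff_smoothing (ρ.integrable_scaled ε) hg
  rw [fun_iteratedFDeriv_sub_apply (hs.of_le (le_inf i)).contDiffAt
    (hg.contDiff.of_le (le_inf i)).contDiffAt, iteratedFDeriv_smoothing (ρ.integrable_scaled ε) hg]
  exact hC ε y

end MollificationRate

section IntegralExchange

variable {E F : Type*} [NormedAddCommGroup E] [NormedSpace ℝ E]
  [NormedAddCommGroup F] [NormedSpace ℝ F]

namespace HasBoundedDerivs

lemma comp_add_right {g : E → F} (hg : HasBoundedDerivs g) (t : E) :
    HasBoundedDerivs fun y => g (y + t) := by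
  refine ⟨hg.contDiff.comp (contDiff_id.add contDiff_const), fun i => ?_⟩
  obtain ⟨M, hM⟩ := hg.bounded i
  exact ⟨M, fun z => by rw [iteratedFDeriv_comp_add_right]; exact hM _⟩

lemma smoothing [MeasureSpace E] [OpensMeasurableSpace E] [SecondCountableTopology E]
    [NormedSpace ℂ F] [IsScalarTower ℝ ℂ F] [CompleteSpace F] {κ : E → ℂ} (hκ : Integrable κ)
    {g : E → F} (hg : HasBoundedDerivs g) : HasBoundedDerivs (smoothing κ g) := by
  refine ⟨contDiff_smoothing hκ hg, fun i => ?_⟩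
  obtain ⟨M, hM⟩ := hg.bounded i
  refine ⟨∫ t, ‖κ t‖ * M, fun z => ?_⟩
  rw [iteratedFDeriv_smoothing hκ hg]
  refine norm_integral_le_of_norm_le (hκ.norm.mul_const M) (Eventually.of_forall fun t => ?_)
  rw [norm_smul]
  exact mul_le_mul_of_nonneg_left (hM _) (norm_nonneg _)

/-- A function with bounded derivatives, as an element of the Banach space of bounded continuous
functions. -/
def toBoundedContinuousFunction {g : E → F} (hg : HasBoundedDerivs g) :
    BoundedContinuousFunction E F :=
  .ofNormedAddCommGroup g hg.contDiff.continuous hg.exists_norm_le.choose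
    hg.exists_norm_le.choose_spec

lemma continuous_translate {g : E → F} (hg : HasBoundedDerivs g) :
    Continuous fun t => (hg.comp_add_right t).toBoundedContinuousFunction := by
  obtain ⟨M, hM⟩ := hg.fderiv.exists_norm_le
  have hM0 : 0 ≤ M := (norm_nonneg _).trans (hM 0)
  refine (LipschitzWith.of_dist_le_mul (K := ⟨M, hM0⟩) fun s t => ?_).continuous
  refine (BoundedContinuousFunction.dist_le (mul_nonneg hM0 dist_nonneg)).2 fun y => ?_
  have lipschitz := (convex_univ (𝕜 := ℝ) (E := E)).norm_image_sub_le_of_norm_fderiv_le (f := g)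
    (fun x _ => hg.contDiff.differentiable (by simp) x) (fun x _ => hM x)
    (Set.mem_univ (y + t)) (Set.mem_univ (y + s))
  rwa [add_sub_add_left_eq_sub, ← dist_eq_norm, ← dist_eq_norm] at lipschitz

end HasBoundedDerivs

variable (E F) [NormedSpace ℂ F] [SMulCommClass ℝ ℂ F]

/-- The complex vector space of the functions with bounded derivatives. -/
def boundedDerivs : Submodule ℂ (E → F) where
  carrier := {g | HasBoundedDerivs g}
  zero_mem' := ⟨contDiff_const, fun i => ⟨0, fun z => by simp [Pi.zero_def]⟩⟩
  add_mem' {f g} hf hg := by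
    refine ⟨hf.contDiff.add hg.contDiff, fun i => ?_⟩
    obtain ⟨M, hM⟩ := hf.bounded i
    obtain ⟨N, hN⟩ := hg.bounded i
    refine ⟨M + N, fun z => ?_⟩
    rw [iteratedFDeriv_add_apply (hf.contDiff.contDiffAt.of_le (le_inf i))
      (hg.contDiff.contDiffAt.of_le (le_inf i))]
    exact norm_add_le_of_le (hM z) (hN z)
  smul_mem' c f hf := by
    refine ⟨contDiff_const.smul hf.contDiff, fun i => ?_⟩
    obtain ⟨M, hM⟩ := hf.bounded i
    refine ⟨‖c‖ * M, fun z => ?_⟩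
    rw [iteratedFDeriv_const_smul_apply (hf.contDiff.contDiffAt.of_le (le_inf i)), norm_smul]
    exact mul_le_mul_of_nonneg_left (hM z) (norm_nonneg c)

/-- The Banach space where the jets of order `n` live: one bounded continuous function for each
order of differentiation. It is a type of its own because the norm of the dependent product is not
found by instance search. -/
def JetSpace (n : ℕ) : Type _ :=
  ∀ i : Fin (n + 1), BoundedContinuousFunction E (E [×(i : ℕ)]→L[ℝ] F)

instance (n : ℕ) : NormedAddCommGroup (JetSpace E F n) :=
  Pi.normedAddCommGroup

instance (n : ℕ) : NormedSpace ℂ (JetSpace E F n) :=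
  Pi.normedSpace

instance (n : ℕ) [CompleteSpace F] : CompleteSpace (JetSpace E F n) :=
  inferInstanceAs (CompleteSpace
    (∀ i : Fin (n + 1), BoundedContinuousFunction E (E [×(i : ℕ)]→L[ℝ] F)))

/-- The entry of degree `i` at the point `y`, as a functional on the space of jets. -/
def evalJet {n : ℕ} (i : Fin (n + 1)) (y : E) : JetSpace E F n →L[ℂ] E [×(i : ℕ)]→L[ℝ] F :=
  (BoundedContinuousFunction.evalCLM ℂ y).comp (ContinuousLinearMap.proj (R := ℂ)
    (φ := fun i : Fin (n + 1) => BoundedContinuousFunction E (E [×(i : ℕ)]→L[ℝ] F)) i)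

/-- The jet of order `n` of a function with bounded derivatives: its derivatives of order at most
`n`, measured in the supremum norm. -/
def jet (n : ℕ) : boundedDerivs E F →ₗ[ℂ] JetSpace E F n where
  toFun g i := (g.2.iteratedFDeriv i).toBoundedContinuousFunction
  map_add' f g := by
    funext i
    ext1 y
    exact iteratedFDeriv_add_apply (f.2.contDiff.contDiffAt.of_le (le_inf i))
      (g.2.contDiff.contDiffAt.of_le (le_inf i))
  map_smul' c f := by
    funext i
    ext1 y
    exact iteratedFDeriv_const_smul_apply (f.2.contDiff.contDiffAt.of_le (le_inf i))

variable {E F}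

lemma norm_jet_le {n : ℕ} (g : boundedDerivs E F) {M : ℝ}
    (hM : ∀ i ≤ n, ∀ y, ‖iteratedFDeriv ℝ i g.1 y‖ ≤ M) : ‖jet E F n g‖ ≤ M := by
  have hM0 : 0 ≤ M := (norm_nonneg _).trans (hM 0 (Nat.zero_le _) 0)
  exact (pi_norm_le_iff_of_nonneg hM0).2 fun i =>
    (BoundedContinuousFunction.norm_le hM0).2 (hM i (Nat.le_of_lt_succ i.2))

lemma norm_iteratedFDeriv_le_norm_jet {n : ℕ} (g : boundedDerivs E F) {i : ℕ} (hi : i ≤ n)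
    (y : E) : ‖iteratedFDeriv ℝ i g.1 y‖ ≤ ‖jet E F n g‖ :=
  ((jet E F n g ⟨i, Nat.lt_succ_of_le hi⟩).norm_coe_le_norm y).trans
    (norm_le_pi_norm (G := fun i : Fin (n + 1) =>
      BoundedContinuousFunction E (E [×(i : ℕ)]→L[ℝ] F)) (jet E F n g) _)

/-- The translate `y ↦ g (y + t)`. -/
def translate (g : boundedDerivs E F) (t : E) : boundedDerivs E F :=
  ⟨fun y => g.1 (y + t), g.2.comp_add_right t⟩

lemma jet_translate_apply (n : ℕ) (g : boundedDerivs E F) (t : E) (i : Fin (n + 1)) (y : E) :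
    jet E F n (translate g t) i y = iteratedFDeriv ℝ i g.1 (y + t) :=
  iteratedFDeriv_comp_add_right (i : ℕ) t y

lemma continuous_jet_translate (n : ℕ) (g : boundedDerivs E F) :
    Continuous fun t => jet E F n (translate g t) := by
  refine continuous_pi fun i => (g.2.iteratedFDeriv i).continuous_translate.congr fun t => ?_
  ext1 y
  exact (jet_translate_apply n g t i y).symm

lemma exists_continuousLinearMap_comp_eq {V B : Type*} [AddCommGroup V] [Module ℂ V]
    [NormedAddCommGroup B] [NormedSpace ℂ B] (J : V →ₗ[ℂ] B) (T : V →ₗ[ℂ] ℂ) {C : ℝ}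
    (hT : ∀ v, ‖T v‖ ≤ C * ‖J v‖) : ∃ L : B →L[ℂ] ℂ, ∀ v, L (J v) = T v := by
  obtain ⟨L, hL, -⟩ := exists_extension_norm_eq J.range (T.extendOfNorm J.rangeRestrict)
  refine ⟨L, fun v => (hL (J.rangeRestrict v)).trans ?_⟩
  exact LinearMap.extendOfNorm_eq J.surjective_rangeRestrict.denseRange ⟨C, hT⟩ v

variable [MeasureSpace E] [OpensMeasurableSpace E] [SecondCountableTopology E]

lemma integrable_smul_jet_translate {κ : E → ℂ} (hκ : Integrable κ) (n : ℕ)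
    (g : boundedDerivs E F) : Integrable fun t => κ t • jet E F n (translate g t) := by
  choose M hM using g.2.bounded
  refine hκ.smul_bdd (∑ i ∈ Finset.range (n + 1), M i)
    (continuous_jet_translate n g).aestronglyMeasurable (Eventually.of_forall fun t => ?_)
  refine norm_jet_le _ fun i hi y => ?_
  refine le_of_eq_of_le (congrArg norm (iteratedFDeriv_comp_add_right i t y)) ?_
  exact (hM i (y + t)).trans <| Finset.single_le_sum (fun j _ => (norm_nonneg _).trans (hM j 0))
    (Finset.mem_range_succ_iff.2 hi)

variable [IsScalarTower ℝ ℂ F] [CompleteSpace F]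

lemma integral_smul_jet_translate {κ : E → ℂ} (hκ : Integrable κ) (n : ℕ)
    (g : boundedDerivs E F) :
    ∫ t, κ t • jet E F n (translate g t) = jet E F n ⟨smoothing κ g.1, g.2.smoothing hκ⟩ := by
  have hint := integrable_smul_jet_translate hκ n g
  funext i
  ext1 y
  change _ = iteratedFDeriv ℝ i (smoothing κ g.1) y
  rw [iteratedFDeriv_smoothing hκ g.2, smoothing]
  have eval_integral := (evalJet E F i y).integral_comp_comm hint
  refine eval_integral.symm.trans (integral_congr_ae (Eventually.of_forall fun t => ?_))
  exact congrArg (κ t • ·) (jet_translate_apply n g t i y)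

/-- By the Hahn–Banach theorem, a functional controlled by finitely many derivatives is a
continuous functional of the jet, and such a functional commutes with Bochner integrals. -/
lemma map_smoothing_eq_integral (T : boundedDerivs E F →ₗ[ℂ] ℂ) {n : ℕ} {C : ℝ}
    (hT : ∀ (g : boundedDerivs E F) (M : ℝ),
      (∀ i ≤ n, ∀ y, ‖iteratedFDeriv ℝ i g.1 y‖ ≤ M) → ‖T g‖ ≤ C * M)
    {κ : E → ℂ} (hκ : Integrable κ) (g : boundedDerivs E F) :
    T ⟨smoothing κ g.1, g.2.smoothing hκ⟩ = ∫ t, κ t * T (translate g t) := by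
  obtain ⟨L, hL⟩ := exists_continuousLinearMap_comp_eq (jet E F n) T (C := C)
    fun g => hT g _ fun i hi y => norm_iteratedFDeriv_le_norm_jet g hi y
  rw [← hL, ← integral_smul_jet_translate hκ,
    ← L.integral_comp_comm (integrable_smul_jet_translate hκ n g)]
  simp only [map_smul, hL, smul_eq_mul]

end IntegralExchange

section Pairing

/-- The test functions on the whole space. -/
abbrev TestFun (d : ℕ) (F : Type) [NormedAddCommGroup F] [NormedSpace ℝ F] : Type :=
  𝓓((⊤ : TopologicalSpace.Opens (Space d)), F)

lemma hasBoundedDerivs_testFun {F : Type} [NormedAddCommGroup F] [NormedSpace ℝ F]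
    (φ : TestFun d F) : HasBoundedDerivs φ :=
  .of_hasCompactSupport φ.contDiff φ.hasCompactSupport

lemma Mollifier.hasBoundedDerivs_scaled (ρ : Mollifier d) (ε : Param) :
    HasBoundedDerivs (ρ.scaled ε) := by
  refine ⟨ρ.contDiff_scaled ε, fun i => ?_⟩
  obtain ⟨M, -, hM⟩ := norm_scaled_le ρ i
  exact ⟨_, hM ε⟩

lemma HasBoundedDerivs.reflect {r : Space d → ℂ} (hr : HasBoundedDerivs r) (x : Space d) :
    HasBoundedDerivs fun y => r (x - y) := by
  refine ⟨hr.contDiff.comp (contDiff_const.sub contDiff_id), fun i => ?_⟩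
  obtain ⟨M, hM⟩ := hr.bounded i
  exact ⟨M, fun y => (norm_iteratedFDeriv_reflect r x y i).trans_le (hM _)⟩

/-- The functional `f ↦ ⟨w, ψ f⟩` on the functions with bounded derivatives. -/
def Dist.cutoff (w : Dist d) (ψ : TestFun d ℝ) : boundedDerivs (Space d) ℂ →ₗ[ℂ] ℂ where
  toFun f := w (cutTest ψ f f.2.contDiff)
  map_add' f g := (congrArg w (cutTest_add ψ f.2.contDiff g.2.contDiff _)).trans (map_add w _ _)
  map_smul' c f := (congrArg w (cutTest_smul ψ f.2.contDiff c _)).trans (map_smul w _ _)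

lemma Dist.map_cutTest_smoothing (w : Dist d) (ψ : TestFun d ℝ) {κ g : Space d → ℂ}
    (hκ : Integrable κ) (hg : HasBoundedDerivs g) :
    w (cutTest ψ (smoothing κ g) (contDiff_smoothing hκ hg)) =
      ∫ t, κ t * w (cutTest ψ (fun y => g (y + t)) (hg.comp_add_right t).contDiff) := by
  obtain ⟨n, C, -, hw⟩ := exists_cutTest_bound w ψ
  exact map_smoothing_eq_integral (w.cutoff ψ) (fun g M hM => hw g.1 g.2.contDiff M hM) hκ ⟨g, hg⟩

lemma smoothing_eq_smoothing_neg (r g : Space d → ℂ) :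
    smoothing r g = smoothing (fun t => g (-t)) fun y => r (-y) := by
  funext y
  calc ∫ t, r t • g (y + t) = ∫ t, (fun x => r (x - y) • g x) (y + t) := by
        simp only [add_sub_cancel_left]
    _ = ∫ x, r (x - y) • g x := integral_add_left_eq_self (fun x => r (x - y) • g x) y
    _ = ∫ t, r (-t - y) • g (-t) := (integral_neg_eq_self (fun x => r (x - y) • g x) volume).symm
    _ = ∫ t, g (-t) • r (-(y + t)) := by
        simp only [neg_add_rev, sub_eq_add_neg, smul_eq_mul, mul_comm]

lemma Dist.integral_mul_cutConv (w : Dist d) (ψ : TestFun d ℝ) {r g : Space d → ℂ}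
    (hr : HasBoundedDerivs r) (hg : Integrable g) (hs : ContDiff ℝ ∞ (smoothing r g)) :
    ∫ x, g x * cutConv w ψ r hr.contDiff x = w (cutTest ψ (smoothing r g) hs) := by
  have hr' : HasBoundedDerivs fun y => r (-y) := by simpa using hr.reflect 0
  simp only [smoothing_eq_smoothing_neg r g]
  rw [w.map_cutTest_smoothing ψ hg.comp_neg hr',
    ← integral_neg_eq_self (fun x => g x * cutConv w ψ r hr.contDiff x) volume]
  simp only [cutConv, neg_add_rev, sub_eq_add_neg]

lemma continuous_cutConv (w : Dist d) (ψ : TestFun d ℝ) {r : Space d → ℂ}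
    (hr : HasBoundedDerivs r) : Continuous (cutConv w ψ r hr.contDiff) :=
  continuous_iff_continuousAt.2 fun x => by
    obtain ⟨L, hL, -⟩ := hasFDerivAt_cutConv w ψ hr.contDiff hr.bounded x
    exact hL.continuousAt

lemma norm_integral_mul_cutConv_sub_le (ρ : Mollifier d) (w : Dist d) (ψ : TestFun d ℝ)
    {φ : TestFun d ℂ} (hψ : ∀ x, ψ x • φ x = φ x) (m : ℕ) :
    ∃ C, ∀ ε : Param, ‖(∫ x, φ x * cutConv w ψ (ρ.scaled ε) (ρ.contDiff_scaled ε) x) - w φ‖ ≤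
      C * (ε : ℝ) ^ m := by
  have hφ := hasBoundedDerivs_testFun φ
  obtain ⟨n, C, -, hw⟩ := exists_cutTest_bound w ψ
  choose B hB using fun i => norm_iteratedFDeriv_smoothing_scaled_sub_le ρ hφ m i
  refine ⟨C * ∑ i ∈ Finset.range (n + 1), |B i|, fun ε => ?_⟩
  have hs := contDiff_smoothing (ρ.integrable_scaled ε) hφ
  have map_eq : w φ = w (cutTest ψ φ φ.contDiff) := congrArg w <| by ext x; exact (hψ x).symm
  have sub_eq : cutTest ψ (smoothing (ρ.scaled ε) φ) hs - cutTest ψ φ φ.contDiff =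
      cutTest ψ (fun y => smoothing (ρ.scaled ε) φ y - φ y) (hs.sub φ.contDiff) := by
    ext y
    exact (smul_sub _ _ _).symm
  rw [w.integral_mul_cutConv ψ (ρ.hasBoundedDerivs_scaled ε)
    (φ.continuous.integrable_of_hasCompactSupport φ.hasCompactSupport) hs, map_eq, ← map_sub,
    sub_eq, mul_assoc]
  refine hw _ _ _ fun i hi y => (hB i ε y).trans ?_
  refine mul_le_mul_of_nonneg_right ((le_abs_self _).trans ?_) (pow_nonneg ε.2.1.le m)
  exact Finset.single_le_sum (f := fun i => |B i|) (fun i _ => abs_nonneg _)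
    (Finset.mem_range_succ_iff.2 hi)

namespace CutoffSystem

lemma exists_finset (P : CutoffSystem d) {K : Set (Space d)} (hK : IsCompact K) :
    ∃ S : Finset ℕ, ∀ x ∈ K, ∀ j ∉ S, P.χ j x = 0 := by
  have hfin := P.locallyFinite.finite_nonempty_inter_compact hK
  refine ⟨hfin.toFinset, fun x hx j hj => ?_⟩
  by_contra h
  exact hj (hfin.mem_toFinset.2 ⟨x, h, hx⟩)

lemma sum_χ_eq_one (P : CutoffSystem d) {S : Finset ℕ} {x : Space d}
    (hS : ∀ j ∉ S, P.χ j x = 0) : ∑ j ∈ S, P.χ j x = 1 := by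
  rw [← P.sum_eq_one x]
  refine (finsum_eq_sum_of_support_subset _ fun j hj => ?_).symm
  by_contra h
  exact hj (hS j h)

lemma ψ_mul_χ (P : CutoffSystem d) (j : ℕ) (x : Space d) : P.ψ j x * P.χ j x = P.χ j x := by
  by_cases hx : x ∈ tsupport (P.χ j)
  · rw [(P.cutoff j).self_of_nhdsSet x hx, one_mul]
  · rw [image_eq_zero_of_notMem_tsupport hx, mul_zero]

lemma sum_cutTest_χ (P : CutoffSystem d) {S : Finset ℕ} {φ : TestFun d ℂ}
    (hS : ∀ x ∈ tsupport φ, ∀ j ∉ S, P.χ j x = 0) :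
    ∑ j ∈ S, cutTest (P.χ j) φ φ.contDiff = φ := by
  ext x
  rw [sum_apply]
  change ∑ j ∈ S, P.χ j x • φ x = φ x
  rw [← Finset.sum_smul]
  by_cases hx : x ∈ tsupport φ
  · rw [P.sum_χ_eq_one (hS x hx), one_smul]
  · rw [image_eq_zero_of_notMem_tsupport hx, smul_zero]

end CutoffSystem

lemma embedNet_eq_sum (ρ : Mollifier d) (P : CutoffSystem d) (w : Dist d) (ε : Param)
    {S : Finset ℕ} {x : Space d} (hS : ∀ j ∉ S, P.χ j x = 0) :
    embedNet ρ P w ε x = ∑ j ∈ S, (P.χ j x : ℂ) *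
      cutConv w (P.ψ j) (ρ.scaled ε) (ρ.contDiff_scaled ε) x := by
  refine finsum_eq_sum_of_support_subset _ fun j hj => ?_
  by_contra h
  exact hj (by simp [hS j h])

lemma integral_embedNet_mul (ρ : Mollifier d) (P : CutoffSystem d) (w : Dist d) (ε : Param)
    {S : Finset ℕ} {φ : TestFun d ℂ} (hS : ∀ x ∈ tsupport φ, ∀ j ∉ S, P.χ j x = 0) :
    ∫ x, embedNet ρ P w ε x * φ x = ∑ j ∈ S, ∫ x, cutTest (P.χ j) φ φ.contDiff x *
      cutConv w (P.ψ j) (ρ.scaled ε) (ρ.contDiff_scaled ε) x := by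
  rw [← integral_finsetSum]
  · refine integral_congr_ae (Eventually.of_forall fun x => ?_)
    change embedNet ρ P w ε x * φ x = ∑ j ∈ S, (P.χ j x • φ x) * _
    by_cases hx : x ∈ tsupport φ
    · rw [embedNet_eq_sum ρ P w ε (hS x hx), Finset.sum_mul]
      exact Finset.sum_congr rfl fun j _ => by rw [Complex.real_smul, mul_right_comm]
    · simp [image_eq_zero_of_notMem_tsupport hx]
  · exact fun j _ => ((cutTest (P.χ j) φ φ.contDiff).continuous.mul
      (continuous_cutConv w (P.ψ j) (ρ.hasBoundedDerivs_scaled ε))).integrable_of_hasCompactSupport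
      (cutTest (P.χ j) φ φ.contDiff).hasCompactSupport.mul_right

theorem Gen.pair_embed (ρ : Mollifier d) (P : CutoffSystem d) (w : Dist d) (φ : TestFun d ℂ) :
    Gen.pair φ (embed ρ P w) = algebraMap ℂ GenNum (w φ) := by
  obtain ⟨S, hS⟩ := P.exists_finset φ.hasCompactSupport
  have cutoff_eq : ∀ j x,
      P.ψ j x • cutTest (P.χ j) φ φ.contDiff x = cutTest (P.χ j) φ φ.contDiff x := fun j x =>
    (smul_smul _ _ _).trans (congrArg (· • φ x) (P.ψ_mul_χ j x))
  rw [embed, Gen.pair_mk]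
  refine Ideal.Quotient.eq.2 fun m => ?_
  choose C hC using fun j => norm_integral_mul_cutConv_sub_le ρ w (P.ψ j) (cutoff_eq j) m
  refine ⟨∑ j ∈ S, C j, Eventually.of_forall fun ε => ?_⟩
  change ‖(∫ x, embedNet ρ P w ε x * φ x) - w φ‖ ≤ _
  rw [integral_embedNet_mul ρ P w ε hS, ← congrArg w (P.sum_cutTest_χ hS), map_sum,
    ← Finset.sum_sub_distrib, Finset.sum_mul]
  exact norm_sum_le_of_le _ fun j _ => hC j ε

lemma integral_dilate_mul {c : ℝ} (hc : 0 < c) (φ : TestFun d ℂ) (f : Space d → ℂ) :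
    ∫ x, dilate c hc φ x * f x = ∫ x, φ x * f (c • x) := by
  have change_of_variables := Measure.integral_comp_inv_smul (μ := (volume : Measure (Space d)))
    (fun x => φ x * f (c • x)) c
  rw [finrank_euclideanSpace_fin, abs_of_nonneg (pow_nonneg hc.le d)] at change_of_variables
  simp only [smul_inv_smul₀ hc.ne'] at change_of_variables
  calc ∫ x, dilate c hc φ x * f x = ∫ x, (((c ^ d)⁻¹ : ℝ) : ℂ) * (φ (c⁻¹ • x) * f x) :=
        congrArg _ (funext fun x => mul_assoc _ _ _)
    _ = ∫ x, φ x * f (c • x) := by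
        rw [integral_const_mul, change_of_variables, Complex.real_smul, ← mul_assoc,
          ← Complex.ofReal_mul, inv_mul_cancel₀ (pow_ne_zero d hc.ne'), Complex.ofReal_one, one_mul]

/-- A test function on an open set, as a test function on the whole space. -/
def extend {Ω : TopologicalSpace.Opens (Space d)} (φ : 𝓓(Ω, ℂ)) : TestFun d ℂ where
  toFun := φ
  contDiff' := φ.contDiff
  hasCompactSupport' := φ.hasCompactSupport
  tsupport_subset' := fun _ _ => trivial

namespace Gen

variable {Ω : TopologicalSpace.Opens (Space d)}

lemma pair_extend (φ : 𝓓(Ω, ℂ)) (u : Gen d) : pair (extend φ) u = pair φ u := by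
  obtain ⟨u, rfl⟩ := Ideal.Quotient.mk_surjective u
  rfl

lemma pair_const_mul (φ : 𝓓(Ω, ℂ)) (a : GenNum) (u : Gen d) :
    pair φ (const d a * u) = a * pair φ u := by
  obtain ⟨u, rfl⟩ := Ideal.Quotient.mk_surjective u
  obtain ⟨a, rfl⟩ := Ideal.Quotient.mk_surjective a
  refine congrArg (Ideal.Quotient.mk numNegligible) (?_ :
    pairMod φ (constMod d a * u) = a * pairMod φ u)
  ext ε
  exact (congrArg _ (funext fun x => mul_assoc _ _ _)).trans (integral_const_mul _ _)

lemma pair_smul (φ : 𝓓(Ω, ℂ)) (c : ℂ) (u : Gen d) :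
    pair φ (c • u) = algebraMap ℂ GenNum c * pair φ u := by
  rw [← pair_const_mul, AlgHom.commutes]
  exact congrArg (pair φ) (Algebra.smul_def c u)

lemma pair_scale {c : ℝ} (hc : 0 < c) (φ : TestFun d ℂ) (u : Gen d) :
    pair φ (scale c u) = pair (dilate c hc φ) u := by
  obtain ⟨u, rfl⟩ := Ideal.Quotient.mk_surjective u
  refine congrArg (Ideal.Quotient.mk numNegligible) (?_ :
    pairMod φ (scaleMod d c u) = pairMod (dilate c hc φ) u)
  ext ε
  change ∫ x, (u : Param → Space d → ℂ) ε (c • x) * φ x =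
    ∫ x, (u : Param → Space d → ℂ) ε x * dilate c hc φ x
  simp only [mul_comm _ (φ _), mul_comm _ (dilate c hc φ _), integral_dilate_mul]

end Gen

theorem Dist.IsHomogeneous.isWeaklyHomogeneous_embed (ρ : Mollifier d) (P : CutoffSystem d)
    {w : Dist d} {α : ℝ} (hw : w.IsHomogeneous α) : (embed ρ P w).IsWeaklyHomogeneous α := by
  intro c hc φ
  rw [← Gen.pair_extend, ← Gen.pair_extend φ, Gen.pair_scale hc, Gen.pair_smul,
    Gen.pair_embed, Gen.pair_embed, hw, map_mul]

end Pairing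

section Derivatives

/-- The function `f` is positively homogeneous of degree `β`. -/
def IsPosHomogeneous {V F : Type*} [SMul ℝ V] [SMul ℝ F] (f : V → F) (β : ℝ) : Prop :=
  ∀ c : ℝ, 0 < c → ∀ x, f (c • x) = c ^ β • f x

lemma lineDerivOp_testFun_apply {F : Type} [NormedAddCommGroup F] [NormedSpace ℝ F]
    (v : Space d) (φ : TestFun d F) (x : Space d) :
    (∂_{v} φ : TestFun d F) x = fderiv ℝ φ x v := by
  rw [TestFunction.lineDerivOp_eq_lineDerivCLM ℝ, TestFunction.lineDerivCLM_eq_fderivCLM,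
    TestFunction.fderivCLM_apply_of_le _ (by exact le_top)]

lemma lineDerivOp_dilate {c : ℝ} (hc : 0 < c) (v : Space d) (φ : TestFun d ℂ) :
    ∂_{v} (dilate c hc φ) = ((c⁻¹ : ℝ) : ℂ) • dilate c hc (∂_{v} φ) := by
  ext x
  rw [lineDerivOp_testFun_apply]
  change fderiv ℝ (fun x => (((c ^ d)⁻¹ : ℝ) : ℂ) * φ (c⁻¹ • x)) x v =
    ((c⁻¹ : ℝ) : ℂ) * ((((c ^ d)⁻¹ : ℝ) : ℂ) * (∂_{v} φ : TestFun d ℂ) (c⁻¹ • x))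
  have differentiable : DifferentiableAt ℝ (fun x => φ (c⁻¹ • x)) x :=
    (φ.contDiff.differentiable (by simp)).comp (differentiable_id.const_smul c⁻¹) x
  rw [fderiv_const_mul differentiable, fderiv_comp_smul, lineDerivOp_testFun_apply,
    smul_apply, smul_apply, smul_eq_mul, Complex.real_smul, mul_left_comm]

lemma lineDerivOp_cutTest (v : Space d) (ψ : TestFun d ℝ) {g : Space d → ℂ}
    (hg : ContDiff ℝ ∞ g) :
    ∂_{v} (cutTest ψ g hg) = cutTest (∂_{v} ψ) g hg +
      cutTest ψ (fun y => fderiv ℝ g y v) (contDiff_dirDeriv hg v) := by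
  ext y
  rw [lineDerivOp_testFun_apply]
  change fderiv ℝ (fun y => ψ y • g y) y v =
    (∂_{v} ψ : TestFun d ℝ) y • g y + ψ y • fderiv ℝ g y v
  rw [fderiv_fun_smul (ψ.contDiff.differentiable (by simp) y) (hg.differentiable (by simp) y),
    lineDerivOp_testFun_apply, add_comm]
  rfl

namespace Dist

/-- The derivative of a distribution in the direction `v`. -/
def lineDeriv (v : Space d) (w : Dist d) : Dist d :=
  -(w.comp (TestFunction.lineDerivCLM ℂ v))

lemma lineDeriv_apply (v : Space d) (w : Dist d) (φ : TestFun d ℂ) :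
    w.lineDeriv v φ = -w (∂_{v} φ) := rfl

lemma IsHomogeneous.lineDeriv {w : Dist d} {α : ℝ} (hw : w.IsHomogeneous α) (v : Space d) :
    (w.lineDeriv v).IsHomogeneous (α - 1) := by
  intro c hc φ
  rw [lineDeriv_apply, lineDeriv_apply, lineDerivOp_dilate, map_smul, hw, smul_eq_mul,
    Real.rpow_sub hc, Real.rpow_one]
  push_cast
  ring

lemma IsHomogeneous.iterate_lineDeriv {w : Dist d} {α : ℝ} (hw : w.IsHomogeneous α)
    (v : Space d) (k : ℕ) : ((Dist.lineDeriv v)^[k] w).IsHomogeneous (α - k) := by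
  induction k with
  | zero => simpa using hw
  | succ k ih =>
    rw [Function.iterate_succ_apply', Nat.cast_succ, ← sub_sub]
    exact ih.lineDeriv v

end Dist

/-- The regular distribution with density `f`. -/
def regular (f : Space d → ℂ) : Dist d :=
  TestFunction.integralAgainstBilinCLM (ContinuousLinearMap.mul ℂ ℂ) volume f

lemma regular_apply {f : Space d → ℂ} (hf : LocallyIntegrable f) (φ : TestFun d ℂ) :
    regular f φ = ∫ x, φ x * f x :=
  TestFunction.integralAgainstBilinCLM_eq_integral (hf.locallyIntegrableOn _)

lemma IsPosHomogeneous.isHomogeneous_regular {f : Space d → ℂ} {α : ℝ}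
    (hα : IsPosHomogeneous f α) (hf : LocallyIntegrable f) : (regular f).IsHomogeneous α := by
  intro c hc φ
  rw [regular_apply hf, regular_apply hf, integral_dilate_mul]
  simp only [hα c hc, Complex.real_smul, mul_left_comm _ ((c ^ α : ℝ) : ℂ)]
  exact integral_const_mul _ _

end Derivatives

section BlowUp

instance : toZero.IsCountablyGenerated :=
  inferInstanceAs (comap _ _).IsCountablyGenerated

lemma tendsto_coe_toZero : Tendsto (fun ε : Param => (ε : ℝ)) toZero (𝓝 0) := tendsto_comap

lemma tendsto_comp_smul_toZero {F : Type*} [TopologicalSpace F] {f : Space d → F}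
    (hf : Continuous f) (x : Space d) :
    Tendsto (fun ε : Param => f ((ε : ℝ) • x)) toZero (𝓝 (f 0)) :=
  (hf.tendsto 0).comp (by simpa using tendsto_coe_toZero.smul_const x)

instance : toZero.NeBot := by
  refine comap_neBot fun t ht => ?_
  obtain ⟨ε, hε, hε'⟩ := ((eventually_nhdsWithin_of_eventually_nhds ht).and
    (Ioc_mem_nhdsGT (one_pos : (0 : ℝ) < 1))).exists
  exact ⟨⟨ε, hε'⟩, hε⟩

/-- The cut-off `x ↦ ψ (ε x)`, which tends to the constant `ψ 0` as `ε → 0`. -/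
def rescale (ε : Param) (ψ : TestFun d ℝ) : TestFun d ℝ where
  toFun x := ψ ((ε : ℝ) • x)
  contDiff' := ψ.contDiff.comp (contDiff_const_smul _)
  hasCompactSupport' :=
    ψ.hasCompactSupport.comp_homeomorph (Homeomorph.smulOfNeZero (ε : ℝ) ε.2.1.ne')
  tsupport_subset' := fun _ _ => trivial

lemma lineDerivOp_rescale (v : Space d) (ε : Param) (ψ : TestFun d ℝ) :
    ∂_{v} (rescale ε ψ) = (ε : ℝ) • rescale ε (∂_{v} ψ) := by
  ext x
  rw [lineDerivOp_testFun_apply]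
  change fderiv ℝ (fun x => ψ ((ε : ℝ) • x)) x v = (ε : ℝ) • (∂_{v} ψ : TestFun d ℝ) ((ε : ℝ) • x)
  rw [fderiv_comp_smul, lineDerivOp_testFun_apply, smul_apply]

/-- The distribution `w` extends to Schwartz functions `r` by `r ↦ L r`, in the sense that
`⟨w, ψ(ε ·) r⟩` tends to `ψ(0) L r` for every test function `ψ`. -/
def Dist.HasTemperedExtension (w : Dist d) (L : 𝓢(Space d, ℂ) → ℂ) : Prop :=
  ∀ (ψ : TestFun d ℝ) (r : 𝓢(Space d, ℂ)),
    Tendsto (fun ε => w (cutTest (rescale ε ψ) r (r.smooth _))) toZero (𝓝 (ψ 0 • L r))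

lemma Dist.lineDeriv_cutTest_rescale (w : Dist d) (v : Space d) (ψ : TestFun d ℝ)
    (r : 𝓢(Space d, ℂ)) (ε : Param) :
    w.lineDeriv v (cutTest (rescale ε ψ) r (r.smooth _)) =
      w (cutTest (rescale ε ψ) (-∂_{v} r : 𝓢(Space d, ℂ)) (SchwartzMap.smooth _ _)) -
        ((ε : ℝ) : ℂ) * w (cutTest (rescale ε (∂_{v} ψ)) r (r.smooth _)) := by
  rw [lineDeriv_apply, lineDerivOp_cutTest, ← map_neg, neg_add', ← smul_eq_mul, ← map_smul,
    ← map_sub, lineDerivOp_rescale, neg_sub_comm]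
  congr 2
  · ext x
    change -(rescale ε ψ x • fderiv ℝ r x v) =
      rescale ε ψ x • -(∂_{v} r : 𝓢(Space d, ℂ)) x
    rw [SchwartzMap.lineDerivOp_apply_eq_fderiv, smul_neg]
  · ext x
    change ((ε : ℝ) • rescale ε (∂_{v} ψ) x) • r x = ((ε : ℝ) : ℂ) * rescale ε (∂_{v} ψ) x • r x
    rw [smul_assoc, ← Complex.real_smul]

lemma Dist.HasTemperedExtension.lineDeriv {w : Dist d} {L : 𝓢(Space d, ℂ) → ℂ}
    (hw : w.HasTemperedExtension L) (v : Space d) :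
    (w.lineDeriv v).HasTemperedExtension fun r => L (-∂_{v} r) := by
  intro ψ r
  simp only [w.lineDeriv_cutTest_rescale]
  have tendsto_ofReal : Tendsto (fun ε : Param => ((ε : ℝ) : ℂ)) toZero (𝓝 0) :=
    (Complex.continuous_ofReal.tendsto' 0 0 Complex.ofReal_zero).comp tendsto_coe_toZero
  simpa using (hw ψ (-∂_{v} r)).sub (tendsto_ofReal.mul (hw (∂_{v} ψ) r))

lemma Dist.HasTemperedExtension.iterate_lineDeriv {w : Dist d} {L : 𝓢(Space d, ℂ) → ℂ}
    (hw : w.HasTemperedExtension L) (v : Space d) (k : ℕ) :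
    ((Dist.lineDeriv v)^[k] w).HasTemperedExtension fun r => L ((fun r => -∂_{v} r)^[k] r) := by
  induction k with
  | zero => exact hw
  | succ k ih =>
    rw [Function.iterate_succ_apply']
    exact ih.lineDeriv v

/-- The Schwartz function `z ↦ r (y - z)`. -/
def reflect (r : 𝓢(Space d, ℂ)) (y : Space d) : 𝓢(Space d, ℂ) :=
  SchwartzMap.compCLMOfAntilipschitz (g := fun z => y - z) (K := 1) ℂ (by fun_prop)
    (fun a b => by simp [edist_dist, dist_eq_norm, norm_sub_rev]) r

lemma reflect_apply (r : 𝓢(Space d, ℂ)) (y z : Space d) : reflect r y z = r (y - z) := rfl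

lemma neg_lineDerivOp_reflect (v : Space d) (r : 𝓢(Space d, ℂ)) (y : Space d) :
    -∂_{v} (reflect r y) = reflect (∂_{v} r) y := by
  ext z
  have hasFDerivAt_reflect : HasFDerivAt (reflect r y)
      ((fderiv ℝ r (y - z)).comp (-(ContinuousLinearMap.id ℝ (Space d)))) z :=
    (r.differentiable (y - z)).hasFDerivAt.comp z ((hasFDerivAt_id z).const_sub y)
  rw [neg_apply, SchwartzMap.lineDerivOp_apply_eq_fderiv, hasFDerivAt_reflect.fderiv,
    reflect_apply, SchwartzMap.lineDerivOp_apply_eq_fderiv]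
  simp

lemma iterate_neg_lineDerivOp_reflect (v : Space d) (r : 𝓢(Space d, ℂ)) (y : Space d) (k : ℕ) :
    (fun r : 𝓢(Space d, ℂ) => -∂_{v} r)^[k] (reflect r y) =
      reflect ((fun r : 𝓢(Space d, ℂ) => ∂_{v} r)^[k] r) y :=
  Function.Semiconj.iterate_right (f := fun r => reflect r y)
    (fun r => (neg_lineDerivOp_reflect v r y).symm) k r |>.symm

lemma cutConv_scaled (ρ : Mollifier d) {w : Dist d} {α : ℝ} (hw : w.IsHomogeneous α)
    (ψ : TestFun d ℝ) (ε : Param) (y : Space d) :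
    cutConv w ψ (ρ.scaled ε) (ρ.contDiff_scaled ε) ((ε : ℝ) • y) =
      (ε : ℝ) ^ α • w (cutTest (rescale ε ψ) (reflect ρ.ρ y) (SchwartzMap.smooth _ _)) := by
  have hε : (ε : ℝ) ≠ 0 := ε.2.1.ne'
  rw [Complex.real_smul, ← hw ε ε.2.1]
  refine congrArg w ?_
  ext z
  change ψ z • (((((ε : ℝ) ^ d)⁻¹ : ℝ) : ℂ) * ρ.ρ ((ε : ℝ)⁻¹ • ((ε : ℝ) • y - z))) =
    ((((ε : ℝ) ^ d)⁻¹ : ℝ) : ℂ) * (ψ ((ε : ℝ) • (ε : ℝ)⁻¹ • z) • ρ.ρ (y - (ε : ℝ)⁻¹ • z))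
  rw [smul_inv_smul₀ hε, smul_sub, inv_smul_smul₀ hε, mul_smul_comm]

lemma smul_mem_closedBall (ε : Param) (y : Space d) :
    (ε : ℝ) • y ∈ Metric.closedBall (0 : Space d) ‖y‖ := by
  rw [mem_closedBall_zero_iff, norm_smul, Real.norm_of_nonneg ε.2.1.le]
  exact mul_le_of_le_one_left (norm_nonneg _) ε.2.2

lemma tendsto_rpow_smul_embedNet (ρ : Mollifier d) (P : CutoffSystem d) {w : Dist d} {α : ℝ}
    (hα : w.IsHomogeneous α) {L : 𝓢(Space d, ℂ) → ℂ} (hL : w.HasTemperedExtension L)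
    (y : Space d) :
    Tendsto (fun ε : Param => (ε : ℝ) ^ (-α) • embedNet ρ P w ε ((ε : ℝ) • y))
      toZero (𝓝 (L (reflect ρ.ρ y))) := by
  obtain ⟨S, hS⟩ := P.exists_finset (isCompact_closedBall (0 : Space d) ‖y‖)
  have rescaled : ∀ ε : Param, (ε : ℝ) ^ (-α) • embedNet ρ P w ε ((ε : ℝ) • y) =
      ∑ j ∈ S, P.χ j ((ε : ℝ) • y) •
        w (cutTest (rescale ε (P.ψ j)) (reflect ρ.ρ y) (SchwartzMap.smooth _ _)) := fun ε => by
    rw [embedNet_eq_sum ρ P w ε (hS _ (smul_mem_closedBall ε y)), Finset.smul_sum]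
    refine Finset.sum_congr rfl fun j _ => ?_
    rw [cutConv_scaled ρ hα, ← Complex.real_smul, smul_comm, smul_smul ((ε : ℝ) ^ (-α)),
      ← Real.rpow_add ε.2.1, neg_add_cancel, Real.rpow_zero, one_smul]
  have limit_eq : L (reflect ρ.ρ y) = ∑ j ∈ S, P.χ j 0 • P.ψ j 0 • L (reflect ρ.ρ y) := by
    simp only [smul_smul, mul_comm (P.χ _ 0), P.ψ_mul_χ]
    rw [← Finset.sum_smul, P.sum_χ_eq_one (hS 0 (by simp)), one_smul]
  simp only [rescaled]
  rw [limit_eq]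
  exact tendsto_finsetSum _ fun j _ =>
    (tendsto_comp_smul_toZero (P.χ j).continuous y).smul (hL (P.ψ j) _)

lemma Gen.IsHomogeneous.exists_norm_embedNet_sub_le {ρ : Mollifier d} {P : CutoffSystem d}
    {w : Dist d} {β : ℝ} (hβ : (embed ρ P w).IsHomogeneous β) {c : ℝ} (hc : 0 < c) (y : Space d)
    (m : ℕ) :
    ∃ C, ∀ᶠ ε : Param in toZero, ‖embedNet ρ P w ε ((ε : ℝ) • c • y) -
      c ^ β • embedNet ρ P w ε ((ε : ℝ) • y)‖ ≤ C * (ε : ℝ) ^ m := by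
  have mem_negligible : scaleMod d c ⟨embedNet ρ P w, embedNet_mem_moderate ρ P w⟩ -
      ((c ^ β : ℝ) : ℂ) • ⟨embedNet ρ P w, embedNet_mem_moderate ρ P w⟩ ∈ negligible d :=
    Ideal.Quotient.eq.1 (hβ c hc)
  obtain ⟨C, hC⟩ := mem_negligible _ (isCompact_closedBall (0 : Space d) ‖y‖) 0 m
  refine ⟨C, hC.mono fun ε hε => ?_⟩
  have norm_le := hε _ (smul_mem_closedBall ε y)
  rw [norm_iteratedFDeriv_zero] at norm_le
  rw [smul_comm]
  exact norm_le

theorem isPosHomogeneous_reflect_of_isHomogeneous_embed {ρ : Mollifier d} {P : CutoffSystem d}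
    {w : Dist d} {α β : ℝ} (hα : w.IsHomogeneous α) {L : 𝓢(Space d, ℂ) → ℂ}
    (hL : w.HasTemperedExtension L) (hβ : (embed ρ P w).IsHomogeneous β) :
    IsPosHomogeneous (fun y => L (reflect ρ.ρ y)) β := by
  intro c hc y
  obtain ⟨C, hC⟩ := hβ.exists_norm_embedNet_sub_le hc y (⌈α⌉₊ + 1)
  refine sub_eq_zero.1 (tendsto_nhds_unique ((tendsto_rpow_smul_embedNet ρ P hα hL (c • y)).sub
    ((tendsto_rpow_smul_embedNet ρ P hα hL y).const_smul (c ^ β))) ?_)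
  refine squeeze_zero_norm' (a := fun ε : Param => |C| * (ε : ℝ)) ?_
    (by simpa using tendsto_coe_toZero.const_mul |C|)
  filter_upwards [hC] with ε hε
  have rpow_mul_pow_le : (ε : ℝ) ^ (-α) * (ε : ℝ) ^ (⌈α⌉₊ + 1) ≤ ε := by
    rw [← Real.rpow_natCast, ← Real.rpow_add ε.2.1]
    refine (Real.rpow_le_rpow_of_exponent_ge ε.2.1 ε.2.2 ?_).trans_eq (Real.rpow_one _)
    push_cast
    linarith [Nat.le_ceil α]
  rw [smul_comm (c ^ β), ← smul_sub, norm_smul, Real.norm_of_nonneg (Real.rpow_nonneg ε.2.1.le _)]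
  calc (ε : ℝ) ^ (-α) * _ ≤ (ε : ℝ) ^ (-α) * (|C| * (ε : ℝ) ^ (⌈α⌉₊ + 1)) := by
        refine mul_le_mul_of_nonneg_left (hε.trans ?_) (Real.rpow_nonneg ε.2.1.le _)
        exact mul_le_mul_of_nonneg_right (le_abs_self C) (pow_nonneg ε.2.1.le _)
    _ = |C| * ((ε : ℝ) ^ (-α) * (ε : ℝ) ^ (⌈α⌉₊ + 1)) := mul_left_comm _ _ _
    _ ≤ |C| * ε := mul_le_mul_of_nonneg_left rpow_mul_pow_le (abs_nonneg C)

end BlowUp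

section RealLine

open Asymptotics

variable {E : Type*} [NormedAddCommGroup E] [NormedSpace ℝ E] {f : ℝ → E} {β : ℝ}

lemma IsPosHomogeneous.eq_zero_of_neg (hβ : IsPosHomogeneous f β)
    (hdecay : SuperpolynomialDecay atBot Neg.neg (‖f ·‖)) {t : ℝ} (ht : t < 0) : f t = 0 := by
  have tendsto_zero := (hdecay ⌈-β⌉₊).comp (tendsto_id.atTop_mul_const_of_neg ht)
  have le_eventually : ∀ᶠ c : ℝ in atTop, (-t) ^ ⌈-β⌉₊ * ‖f t‖ ≤
      (-(c * t)) ^ ⌈-β⌉₊ * ‖f (c * t)‖ := by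
    filter_upwards [eventually_ge_atTop 1] with c hc
    have hc0 : 0 < c := one_pos.trans_le hc
    have one_le : 1 ≤ c ^ ⌈-β⌉₊ * c ^ β := by
      rw [← Real.rpow_natCast, ← Real.rpow_add hc0]
      exact Real.one_le_rpow hc (by linarith [Nat.le_ceil (-β)])
    rw [← smul_eq_mul c t, hβ c hc0, norm_smul, Real.norm_of_nonneg (Real.rpow_nonneg hc0.le β),
      smul_eq_mul, ← mul_neg, mul_pow, mul_mul_mul_comm]
    have ht' : 0 ≤ -t := by linarith
    exact le_mul_of_one_le_left (by positivity) one_le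
  have norm_le := ge_of_tendsto tendsto_zero le_eventually
  exact norm_le_zero_iff.1
    (nonpos_of_mul_nonpos_right norm_le (pow_pos (neg_pos.2 ht) _))

lemma iteratedDeriv_eq_zero_of_eq_zero_of_neg (hf : ContDiff ℝ ∞ f) (hneg : ∀ t < 0, f t = 0)
    (k : ℕ) : iteratedDeriv k f 0 = 0 := by
  have eqOn_neg : Set.EqOn (iteratedDeriv k f) (fun _ => 0) (Set.Iio 0) := fun t ht => by
    have eventuallyEq : f =ᶠ[𝓝 t] fun _ => 0 := by
      filter_upwards [Iio_mem_nhds ht] with x hx using hneg x hx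
    rw [eventuallyEq.iteratedDeriv_eq, iteratedDeriv_fun_const_zero]
  refine eqOn_neg.closure (hf.continuous_iteratedDeriv k (mod_cast le_top)) continuous_const ?_
  rw [closure_Iio]
  exact Set.self_mem_Iic

lemma isLittleO_pow_of_eq_zero_of_neg (hf : ContDiff ℝ ∞ f) (hneg : ∀ t < 0, f t = 0) (n : ℕ) :
    f =o[𝓝 0] fun t => t ^ n := by
  have taylor := taylor_isLittleO_univ (x₀ := (0 : ℝ)) (n := n) (hf.of_le (mod_cast le_top))
  simpa [taylor_within_apply, iteratedDerivWithin_univ,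
    iteratedDeriv_eq_zero_of_eq_zero_of_neg hf hneg] using taylor

lemma IsPosHomogeneous.eq_zero_of_contDiff (hβ : IsPosHomogeneous f β) (hf : ContDiff ℝ ∞ f)
    (hneg : ∀ t < 0, f t = 0) : f = 0 := by
  have flat := (isLittleO_pow_of_eq_zero_of_neg hf hneg ⌈β⌉₊).tendsto_inv_smul_nhds_zero
  have apply_one : f 1 = 0 := by
    have tendsto_zero := (flat.norm.mono_left nhdsWithin_le_nhds :
      Tendsto (fun t : ℝ => ‖(t ^ ⌈β⌉₊)⁻¹ • f t‖) (𝓝[>] 0) (𝓝 ‖(0 : E)‖))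
    rw [norm_zero] at tendsto_zero
    refine norm_le_zero_iff.1 (ge_of_tendsto tendsto_zero ?_)
    filter_upwards [Ioc_mem_nhdsGT (one_pos : (0 : ℝ) < 1)] with t ht
    have pow_le_rpow : t ^ ⌈β⌉₊ ≤ t ^ β := by
      rw [← Real.rpow_natCast]
      exact Real.rpow_le_rpow_of_exponent_ge ht.1 ht.2 (Nat.le_ceil β)
    have apply_eq : f t = t ^ β • f 1 := by simpa using hβ t ht.1 1
    rw [apply_eq, smul_smul, norm_smul, ← div_eq_inv_mul,
      Real.norm_of_nonneg (div_nonneg (Real.rpow_nonneg ht.1.le β) (pow_nonneg ht.1.le _))]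
    exact le_mul_of_one_le_left (norm_nonneg _) ((one_le_div (pow_pos ht.1 _)).2 pow_le_rpow)
  have apply_zero : f 0 = 0 := by
    simpa using iteratedDeriv_eq_zero_of_eq_zero_of_neg hf hneg 0
  funext t
  rcases lt_trichotomy t 0 with ht | rfl | ht
  · exact hneg t ht
  · exact apply_zero
  · simpa [apply_one] using hβ t ht 1

lemma eq_zero_of_deriv_eq_zero_of_decay (hf : Differentiable ℝ f) (hderiv : deriv f = 0)
    (hdecay : SuperpolynomialDecay atBot Neg.neg (‖f ·‖)) : f = 0 := by
  funext t
  have tendsto_zero : Tendsto f atBot (𝓝 0) := by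
    simpa [tendsto_zero_iff_norm_tendsto_zero] using hdecay 0
  have constant : f = fun _ => f t :=
    funext fun x => is_const_of_deriv_eq_zero hf (congrFun hderiv) x t
  rw [constant] at tendsto_zero
  exact tendsto_nhds_unique tendsto_const_nhds tendsto_zero

lemma eq_zero_of_iteratedDeriv_eq_zero_of_decay (hf : ContDiff ℝ ∞ f)
    (hdecay : ∀ i, SuperpolynomialDecay atBot Neg.neg (‖iteratedDeriv i f ·‖)) {k : ℕ}
    (hk : iteratedDeriv k f = 0) : f = 0 := by
  induction k with
  | zero => simpa using hk
  | succ k ih =>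
    rw [iteratedDeriv_succ] at hk
    exact ih (eq_zero_of_deriv_eq_zero_of_decay
      (hf.differentiable_iteratedDeriv k (mod_cast ENat.natCast_lt_top k)) hk (hdecay k))

theorem eq_zero_of_isPosHomogeneous_iteratedDeriv (hf : ContDiff ℝ ∞ f)
    (hdecay : ∀ i, SuperpolynomialDecay atBot Neg.neg (‖iteratedDeriv i f ·‖)) {k : ℕ}
    (hβ : IsPosHomogeneous (iteratedDeriv k f) β) : f = 0 :=
  eq_zero_of_iteratedDeriv_eq_zero_of_decay hf hdecay <|
    hβ.eq_zero_of_contDiff (iteratedDeriv_eq_iterate (f := f) ▸ hf.iterate_deriv k) fun _ =>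
      hβ.eq_zero_of_neg (hdecay k)

end RealLine

section SchwartzConvolution

open Asymptotics
open scoped Convolution

lemma one_add_norm_sub_le {V : Type*} [SeminormedAddCommGroup V] (x y : V) :
    1 + ‖x - y‖ ≤ (1 + ‖x‖) * (1 + ‖y‖) := by
  nlinarith [norm_sub_le x y, mul_nonneg (norm_nonneg x) (norm_nonneg y)]

lemma exists_one_add_norm_pow_mul_le (r : 𝓢(Space d, ℂ)) (N : ℕ) :
    ∃ M, ∀ x, (1 + ‖x‖) ^ N * ‖r x‖ ≤ M * (1 + ‖x‖) ^ (-((d : ℝ) + 1)) := by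
  refine ⟨2 ^ (N + (d + 1)) * ((Finset.Iic (N + (d + 1), 0)).sup
    fun m => SchwartzMap.seminorm ℝ m.1 m.2) r, fun x => ?_⟩
  have seminorm_bound := SchwartzMap.one_add_le_sup_seminorm_apply (𝕜 := ℝ)
    (m := (N + (d + 1), 0)) (k := N + (d + 1)) (n := 0) le_rfl le_rfl r x
  have pos : (0 : ℝ) < 1 + ‖x‖ := by positivity
  rw [norm_iteratedFDeriv_zero] at seminorm_bound
  rw [Real.rpow_neg pos.le, ← div_eq_mul_inv, le_div_iff₀ (Real.rpow_pos_of_pos pos _),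
    ← Nat.cast_succ, Real.rpow_natCast, mul_right_comm, ← pow_add]
  exact seminorm_bound

lemma integrable_one_add_norm_pow_mul (r : 𝓢(Space d, ℂ)) (N : ℕ) :
    Integrable fun x => (1 + ‖x‖) ^ N * ‖r x‖ := by
  obtain ⟨M, hM⟩ := exists_one_add_norm_pow_mul_le r N
  refine ((integrable_one_add_norm (r := (d : ℝ) + 1) (by simp)).const_mul M).mono'
    (Continuous.aestronglyMeasurable (by fun_prop)) (Eventually.of_forall fun x => ?_)
  rw [Real.norm_of_nonneg (by positivity)]
  exact hM x

/-- The function `f` is measurable and of at most polynomial growth. -/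
structure HasPolynomialGrowth (f : Space d → ℂ) : Prop where
  measurable : Measurable f
  exists_bound : ∃ (C : ℝ) (N : ℕ), ∀ x, ‖f x‖ ≤ C * (1 + ‖x‖) ^ N

/-- The convolution of a Schwartz function `r` with a function `f`. -/
def schwartzConv (f : Space d → ℂ) (r : 𝓢(Space d, ℂ)) : Space d → ℂ :=
  f ⋆[ContinuousLinearMap.mul ℝ ℂ] r

lemma schwartzConv_apply (f : Space d → ℂ) (r : 𝓢(Space d, ℂ)) (y : Space d) :
    schwartzConv f r y = ∫ z, f z * r (y - z) := rfl

lemma schwartzConv_apply' (f : Space d → ℂ) (r : 𝓢(Space d, ℂ)) (y : Space d) :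
    schwartzConv f r y = ∫ z, f (y - z) * r z :=
  convolution_eq_swap _

namespace HasPolynomialGrowth

variable {f : Space d → ℂ}

lemma locallyIntegrable (hf : HasPolynomialGrowth f) : LocallyIntegrable f := by
  obtain ⟨C, N, hC⟩ := hf.exists_bound
  refine (Continuous.locallyIntegrable (f := fun x : Space d => C * (1 + ‖x‖) ^ N)
    (by fun_prop)).mono hf.measurable.aestronglyMeasurable (Eventually.of_forall fun x => ?_)
  exact (hC x).trans (le_abs_self _)

lemma exists_norm_sub_le (hf : HasPolynomialGrowth f) :
    ∃ C ≥ 0, ∃ N, ∀ x y, ‖f (x - y)‖ ≤ C * (1 + ‖x‖) ^ N * (1 + ‖y‖) ^ N := by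
  obtain ⟨C, N, hC⟩ := hf.exists_bound
  refine ⟨|C|, abs_nonneg C, N, fun x y => (hC _).trans ?_⟩
  rw [mul_assoc, ← mul_pow]
  gcongr
  · exact le_abs_self C
  · exact one_add_norm_sub_le x y

lemma exists_norm_mul_schwartz_sub_le (hf : HasPolynomialGrowth f) (r : 𝓢(Space d, ℂ)) (R : ℝ) :
    ∃ B, ∀ x, ‖x‖ ≤ R → ∀ z, ‖f z * r (x - z)‖ ≤ B * (1 + ‖z‖) ^ (-((d : ℝ) + 1)) := by
  obtain ⟨C, hC, N, hf⟩ := hf.exists_norm_sub_le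
  obtain ⟨M, hM⟩ := exists_one_add_norm_pow_mul_le r N
  have hM0 : 0 ≤ M := by simpa using (norm_nonneg _).trans (by simpa using hM 0)
  refine ⟨C * (1 + R) ^ N * (M * (1 + R) ^ ((d : ℝ) + 1)), fun x hx z => ?_⟩
  have hR : 0 ≤ R := (norm_nonneg x).trans hx
  have norm_f_le : ‖f z‖ ≤ C * (1 + R) ^ N * (1 + ‖x - z‖) ^ N := by
    calc ‖f z‖ = ‖f (x - (x - z))‖ := by rw [sub_sub_cancel]
      _ ≤ C * (1 + ‖x‖) ^ N * (1 + ‖x - z‖) ^ N := hf _ _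
      _ ≤ C * (1 + R) ^ N * (1 + ‖x - z‖) ^ N := by gcongr
  have weight_le : (1 + ‖x - z‖) ^ (-((d : ℝ) + 1)) ≤
      (1 + R) ^ ((d : ℝ) + 1) * (1 + ‖z‖) ^ (-((d : ℝ) + 1)) := by
    have one_add_le : (1 + R)⁻¹ * (1 + ‖z‖) ≤ 1 + ‖x - z‖ := by
      rw [inv_mul_le_iff₀ (by positivity)]
      calc 1 + ‖z‖ = 1 + ‖x - (x - z)‖ := by rw [sub_sub_cancel]
        _ ≤ (1 + ‖x‖) * (1 + ‖x - z‖) := one_add_norm_sub_le _ _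
        _ ≤ (1 + R) * (1 + ‖x - z‖) := by gcongr
    refine (Real.rpow_le_rpow_of_nonpos (by positivity) one_add_le
      (by linarith [d.cast_nonneg (α := ℝ)])).trans_eq ?_
    rw [Real.mul_rpow (by positivity) (by positivity), Real.inv_rpow (by positivity),
      Real.rpow_neg (by positivity), inv_inv]
  calc ‖f z * r (x - z)‖ ≤ C * (1 + R) ^ N * ((1 + ‖x - z‖) ^ N * ‖r (x - z)‖) := by
        rw [norm_mul, ← mul_assoc]
        gcongr
    _ ≤ C * (1 + R) ^ N * (M * ((1 + R) ^ ((d : ℝ) + 1) * (1 + ‖z‖) ^ (-((d : ℝ) + 1)))) := by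
        exact mul_le_mul_of_nonneg_left
          ((hM _).trans (mul_le_mul_of_nonneg_left weight_le hM0)) (by positivity)
    _ = _ := by ring

lemma integrable_mul_schwartz_sub (hf : HasPolynomialGrowth f) (r : 𝓢(Space d, ℂ))
    (y : Space d) : Integrable fun z => f z * r (y - z) := by
  obtain ⟨B, hB⟩ := hf.exists_norm_mul_schwartz_sub_le r ‖y‖
  exact ((integrable_one_add_norm (by simp)).const_mul B).mono'
    (hf.measurable.aestronglyMeasurable.mul (reflect r y).continuous.aestronglyMeasurable)
    (Eventually.of_forall (hB y le_rfl))

lemma integrable_mul_schwartz (hf : HasPolynomialGrowth f) (r : 𝓢(Space d, ℂ)) :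
    Integrable fun z => f z * r z := by
  simpa [reflect_apply] using hf.integrable_mul_schwartz_sub (reflect r 0) 0

lemma hasTemperedExtension_regular (hf : HasPolynomialGrowth f) :
    (regular f).HasTemperedExtension fun r => ∫ x, f x * r x := by
  intro ψ r
  obtain ⟨B, hB⟩ := (hasBoundedDerivs_testFun ψ).exists_norm_le
  simp only [regular_apply hf.locallyIntegrable]
  rw [← integral_smul]
  refine tendsto_integral_filter_of_dominated_convergence (fun x => B * ‖f x * r x‖)
    (Eventually.of_forall fun ε => ?_) (Eventually.of_forall fun ε => Eventually.of_forall
      fun x => ?_) ((hf.integrable_mul_schwartz r).norm.const_mul B)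
      (Eventually.of_forall fun x => ?_)
  · exact (cutTest (rescale ε ψ) r (r.smooth _)).continuous.aestronglyMeasurable.mul
      hf.measurable.aestronglyMeasurable
  · change ‖(ψ ((ε : ℝ) • x) • r x) * f x‖ ≤ _
    rw [smul_mul_assoc, norm_smul, mul_comm (r x)]
    exact mul_le_mul_of_nonneg_right (hB _) (norm_nonneg _)
  · change Tendsto (fun ε : Param => (ψ ((ε : ℝ) • x) • r x) * f x) toZero _
    simpa only [smul_mul_assoc, mul_comm (r x)] using
      (tendsto_comp_smul_toZero ψ.continuous x).smul_const (f x * r x)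

lemma hasDerivAt_schwartzConv (hf : HasPolynomialGrowth f) (r : 𝓢(Space d, ℂ)) (v : Space d)
    (t₀ : ℝ) :
    HasDerivAt (fun t : ℝ => schwartzConv f r (t • v)) (schwartzConv f (∂_{v} r) (t₀ • v)) t₀ := by
  obtain ⟨B, hB⟩ := hf.exists_norm_mul_schwartz_sub_le (∂_{v} r) ((|t₀| + 1) * ‖v‖)
  have integrable := fun (q : 𝓢(Space d, ℂ)) (t : ℝ) => hf.integrable_mul_schwartz_sub q (t • v)
  refine (hasDerivAt_integral_of_dominated_loc_of_deriv_le (Metric.ball_mem_nhds t₀ one_pos)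
    (F := fun t z => f z * r (t • v - z)) (F' := fun t z => f z * (∂_{v} r) (t • v - z))
    (Eventually.of_forall fun t => (integrable r t).aestronglyMeasurable) (integrable r t₀)
    (integrable _ t₀).aestronglyMeasurable (Eventually.of_forall fun z t ht => hB _ ?_ z)
    ((integrable_one_add_norm (by simp)).const_mul _)
    (Eventually.of_forall fun z t _ => ?_)).2
  · rw [norm_smul]
    rw [mem_ball_iff_norm, Real.norm_eq_abs] at ht
    refine mul_le_mul_of_nonneg_right ?_ (norm_nonneg v)
    rw [Real.norm_eq_abs]
    linarith [abs_sub_abs_le_abs_sub t t₀]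
  · have line : HasDerivAt (fun t : ℝ => t • v - z) v t := by
      simpa using ((hasDerivAt_id t).smul_const v).sub_const z
    rw [SchwartzMap.lineDerivOp_apply_eq_fderiv]
    exact ((r.differentiable _).hasFDerivAt.comp_hasDerivAt t line).const_mul (f z)

lemma iteratedDeriv_schwartzConv (hf : HasPolynomialGrowth f) (r : 𝓢(Space d, ℂ)) (v : Space d)
    (k : ℕ) : iteratedDeriv k (fun t : ℝ => schwartzConv f r (t • v)) =
      fun t => schwartzConv f ((fun r : 𝓢(Space d, ℂ) => ∂_{v} r)^[k] r) (t • v) := by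
  induction k with
  | zero => simp
  | succ k ih =>
    rw [iteratedDeriv_succ, ih, Function.iterate_succ_apply']
    exact funext fun t => (hf.hasDerivAt_schwartzConv _ v t).deriv

lemma contDiff_schwartzConv (hf : HasPolynomialGrowth f) (r : 𝓢(Space d, ℂ)) (v : Space d) :
    ContDiff ℝ ∞ fun t : ℝ => schwartzConv f r (t • v) :=
  contDiff_of_differentiable_iteratedDeriv fun k _ => by
    rw [hf.iteratedDeriv_schwartzConv r v k]
    exact fun t => (hf.hasDerivAt_schwartzConv _ v t).differentiableAt

lemma superpolynomialDecay_schwartzConv (hf : HasPolynomialGrowth f) {v : Space d}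
    {ℓ : Space d →L[ℝ] ℝ} (hℓ : ℓ v = 1) (hsupp : ∀ x, f x ≠ 0 → 0 ≤ ℓ x) (r : 𝓢(Space d, ℂ)) :
    SuperpolynomialDecay atBot Neg.neg fun t : ℝ => ‖schwartzConv f r (t • v)‖ := by
  obtain ⟨C, hC, N, hC'⟩ := hf.exists_norm_sub_le
  refine (superpolynomialDecay_iff_abs_isBoundedUnder _ tendsto_neg_atBot_atTop).2 fun n => ?_
  refine isBoundedUnder_of_eventually_le (a := ∫ z, C * ‖ℓ‖ ^ n * (1 + ‖ℓ‖ * ‖v‖) ^ N *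
    ((1 + ‖z‖) ^ (n + N + N) * ‖r z‖)) ?_
  filter_upwards [eventually_le_atBot 0] with t ht
  rw [schwartzConv_apply', abs_mul, abs_norm, ← Real.norm_eq_abs, ← norm_smul, ← integral_smul]
  refine norm_integral_le_of_norm_le ((integrable_one_add_norm_pow_mul r _).const_mul _)
    (Eventually.of_forall fun z => ?_)
  rw [norm_smul, norm_mul, norm_pow, norm_neg]
  by_cases hz : f (t • v - z) = 0
  · rw [hz, norm_zero, zero_mul, mul_zero]
    positivity
  have norm_t_le : ‖t‖ ≤ ‖ℓ‖ * ‖z‖ := by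
    have nonneg := hsupp _ hz
    rw [map_sub, map_smul, hℓ, smul_eq_mul, mul_one] at nonneg
    refine le_trans ?_ (ℓ.le_opNorm z)
    rw [Real.norm_of_nonpos ht, Real.norm_of_nonpos (by linarith)]
    linarith
  have norm_tv_le : 1 + ‖t • v‖ ≤ (1 + ‖ℓ‖ * ‖v‖) * (1 + ‖z‖) := by
    rw [norm_smul]
    nlinarith [mul_le_mul_of_nonneg_right norm_t_le (norm_nonneg v), norm_nonneg z,
      mul_nonneg (norm_nonneg ℓ) (norm_nonneg v)]
  calc ‖t‖ ^ n * (‖f (t • v - z)‖ * ‖r z‖)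
      ≤ (‖ℓ‖ * (1 + ‖z‖)) ^ n *
          (C * ((1 + ‖ℓ‖ * ‖v‖) * (1 + ‖z‖)) ^ N * (1 + ‖z‖) ^ N * ‖r z‖) := by
        gcongr
        · exact norm_t_le.trans (by gcongr; linarith)
        · exact (hC' _ _).trans (by gcongr)
    _ = _ := by
        rw [mul_pow, mul_pow]
        ring

lemma tendsto_rpow_smul_schwartzConv (hf : HasPolynomialGrowth f) {s : ℝ}
    (hs : IsPosHomogeneous f s) {v : Space d} (hv : ContinuousAt f v) (r : 𝓢(Space d, ℂ)) :
    Tendsto (fun t : ℝ => t ^ (-s) • schwartzConv f r (t • v)) atTop (𝓝 (f v * ∫ z, r z)) := by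
  obtain ⟨C, hC, N, hC'⟩ := hf.exists_norm_sub_le
  have rescaled : ∀ᶠ t : ℝ in atTop, ∫ z, f (v - t⁻¹ • z) * r z =
      t ^ (-s) • schwartzConv f r (t • v) := by
    filter_upwards [eventually_gt_atTop 0] with t ht
    rw [schwartzConv_apply', ← integral_smul]
    refine congrArg _ (funext fun z => ?_)
    rw [← smul_mul_assoc, Real.rpow_neg ht.le, ← smul_inv_smul₀ ht.ne' z, ← smul_sub, hs t ht,
      inv_smul_smul₀ (Real.rpow_pos_of_pos ht s).ne', inv_smul_smul₀ ht.ne']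
  rw [← integral_const_mul]
  refine Tendsto.congr' rescaled (tendsto_integral_filter_of_dominated_convergence
    (fun z => C * (1 + ‖v‖) ^ N * ((1 + ‖z‖) ^ N * ‖r z‖)) (Eventually.of_forall fun t => ?_) ?_
    ((integrable_one_add_norm_pow_mul r N).const_mul _) (Eventually.of_forall fun z => ?_))
  · exact (hf.measurable.comp (by fun_prop : Measurable fun z : Space d => v - t⁻¹ • z)
      ).aestronglyMeasurable.mul r.continuous.aestronglyMeasurable
  · filter_upwards [eventually_ge_atTop 1] with t ht
    refine Eventually.of_forall fun z => ?_
    have norm_le : ‖t⁻¹ • z‖ ≤ ‖z‖ := by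
      rw [norm_smul, norm_inv, Real.norm_of_nonneg (by linarith)]
      exact mul_le_of_le_one_left (norm_nonneg z) (inv_le_one_of_one_le₀ ht)
    rw [norm_mul, ← mul_assoc]
    gcongr
    exact (hC' _ _).trans (by gcongr)
  · have tendsto_v : Tendsto (fun t : ℝ => v - t⁻¹ • z) atTop (𝓝 v) := by
      simpa using ((tendsto_inv_atTop_zero (𝕜 := ℝ)).smul_const z).const_sub v
    exact (hv.tendsto.comp tendsto_v).mul_const (r z)

theorem not_isHomogeneous_embed_iterate_lineDeriv_regular (hf : HasPolynomialGrowth f) {s : ℝ}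
    (hs : IsPosHomogeneous f s) {v : Space d} (hv : ContinuousAt f v) (hfv : f v ≠ 0)
    {ℓ : Space d →L[ℝ] ℝ} (hℓ : ℓ v = 1) (hsupp : ∀ x, f x ≠ 0 → 0 ≤ ℓ x) (ρ : Mollifier d)
    (P : CutoffSystem d) (k : ℕ) (β : ℝ) :
    ¬ (embed ρ P ((Dist.lineDeriv v)^[k] (regular f))).IsHomogeneous β := by
  intro hβ
  have homogeneous := isPosHomogeneous_reflect_of_isHomogeneous_embed
    ((hs.isHomogeneous_regular hf.locallyIntegrable).iterate_lineDeriv v k)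
    (hf.hasTemperedExtension_regular.iterate_lineDeriv v k) hβ
  simp only [iterate_neg_lineDerivOp_reflect] at homogeneous
  have homogeneous_line :
      IsPosHomogeneous (iteratedDeriv k fun t : ℝ => schwartzConv f ρ.ρ (t • v)) β := by
    rw [hf.iteratedDeriv_schwartzConv]
    intro c hc t
    simpa only [smul_assoc, schwartzConv_apply, reflect_apply] using homogeneous c hc (t • v)
  have conv_eq_zero := eq_zero_of_isPosHomogeneous_iteratedDeriv (hf.contDiff_schwartzConv ρ.ρ v)
    (fun i => by
      rw [hf.iteratedDeriv_schwartzConv]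
      exact hf.superpolynomialDecay_schwartzConv hℓ hsupp _) homogeneous_line
  have limit := hf.tendsto_rpow_smul_schwartzConv hs hv ρ.ρ
  simp only [congrFun conv_eq_zero _, Pi.zero_apply, smul_zero, ρ.integral_eq_one, mul_one] at limit
  exact hfv (tendsto_nhds_unique limit tendsto_const_nhds)

end HasPolynomialGrowth

end SchwartzConvolution

section OrthantPowers

/-- The function `x ↦ ‖x‖ ^ s H(x₁) ⋯ H(x_d)`, where `H` is the Heaviside function. -/
def orthantPower (d : ℕ) (s : ℝ) (x : Space d) : ℂ :=
  ‖x‖ ^ s • ∏ i, heaviside (x i)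

lemma isPosHomogeneous_heaviside : IsPosHomogeneous heaviside 0 := fun c hc t => by
  simp [heaviside, hc]

lemma isPosHomogeneous_orthantPower (s : ℝ) : IsPosHomogeneous (orthantPower d s) s := by
  intro c hc x
  have heaviside_eq : ∀ i, heaviside ((c • x) i) = heaviside (x i) := fun i => by
    simpa using isPosHomogeneous_heaviside c hc (x i)
  rw [orthantPower, norm_smul, Real.norm_of_nonneg hc.le, Real.mul_rpow hc.le (norm_nonneg x),
    mul_smul, orthantPower]
  simp only [heaviside_eq]

lemma measurable_heaviside : Measurable heaviside :=
  Measurable.ite measurableSet_Ioi measurable_const measurable_const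

lemma norm_heaviside_le_one (t : ℝ) : ‖heaviside t‖ ≤ 1 := by
  unfold heaviside
  split_ifs <;> simp

lemma hasPolynomialGrowth_orthantPower {s : ℝ} (hs : 0 ≤ s) :
    HasPolynomialGrowth (orthantPower d s) where
  measurable := (measurable_norm.pow_const s).smul (Finset.measurable_fun_prod _ fun i _ =>
    measurable_heaviside.comp (by fun_prop : Measurable fun x : Space d => x i))
  exists_bound := by
    refine ⟨1, ⌈s⌉₊, fun x => ?_⟩
    rw [orthantPower, norm_smul, norm_prod, mul_comm]
    refine mul_le_mul (Finset.prod_le_one (fun i _ => norm_nonneg _)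
      fun i _ => norm_heaviside_le_one _) ?_ (norm_nonneg _) zero_le_one
    calc ‖‖x‖ ^ s‖ = ‖x‖ ^ s := Real.norm_of_nonneg (by positivity)
      _ ≤ (1 + ‖x‖) ^ s := Real.rpow_le_rpow (norm_nonneg x) (by linarith) hs
      _ ≤ (1 + ‖x‖) ^ (⌈s⌉₊ : ℝ) :=
        Real.rpow_le_rpow_of_exponent_le (by linarith [norm_nonneg x]) (Nat.le_ceil s)
      _ = (1 + ‖x‖) ^ ⌈s⌉₊ := Real.rpow_natCast _ _

lemma nonneg_of_orthantPower_ne_zero {s : ℝ} {x : Space d} (hx : orthantPower d s x ≠ 0)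
    (i : Fin d) : 0 ≤ x i := by
  contrapose! hx
  rw [orthantPower, Finset.prod_eq_zero (Finset.mem_univ i) (if_neg hx.not_gt), smul_zero]

lemma orthantPower_of_pos {s : ℝ} {x : Space d} (hx : ∀ i, 0 < x i) :
    orthantPower d s x = (‖x‖ ^ s : ℝ) := by
  have heaviside_eq_one : ∀ i, heaviside (x i) = 1 := fun i => if_pos (hx i)
  simp [orthantPower, heaviside_eq_one]

lemma continuousAt_orthantPower {s : ℝ} (hs : 0 ≤ s) {x : Space d} (hx : ∀ i, 0 < x i) :
    ContinuousAt (orthantPower d s) x := by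
  have continuous_pow : Continuous fun y : Space d => ((‖y‖ ^ s : ℝ) : ℂ) :=
    Complex.continuous_ofReal.comp (continuous_norm.rpow_const fun _ => Or.inr hs)
  refine continuous_pow.continuousAt.congr ?_
  have eventually_pos : ∀ᶠ y : Space d in 𝓝 x, ∀ i, 0 < y i := eventually_all.2 fun i =>
    (by fun_prop : Continuous fun y : Space d => y i).continuousAt.eventually (lt_mem_nhds (hx i))
  filter_upwards [eventually_pos] with y hy using (orthantPower_of_pos hy).symm

/-- The vector `(1, …, 1)`. -/
def diag (d : ℕ) : Space d := WithLp.toLp 2 fun _ => 1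

lemma diag_apply (i : Fin d) : diag d i = 1 := rfl

/-- A homogeneous distribution of degree `α`: the `k`-th derivative in the direction `(1, …, 1)` of
the `s`-th orthant power, where `k` is the least natural number for which `s = α + k` is
nonnegative, hence the orthant power locally integrable and continuous at `(1, …, 1)`. -/
def homogeneousDist (d : ℕ) (α : ℝ) : Dist d :=
  (Dist.lineDeriv (diag d))^[⌈-α⌉₊] (regular (orthantPower d (α + ⌈-α⌉₊)))

lemma add_ceil_neg_nonneg (α : ℝ) : 0 ≤ α + ⌈-α⌉₊ := by
  linarith [Nat.le_ceil (-α)]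

lemma isHomogeneous_homogeneousDist (α : ℝ) : (homogeneousDist d α).IsHomogeneous α := by
  have homogeneous := ((isPosHomogeneous_orthantPower (d := d) _).isHomogeneous_regular
    (hasPolynomialGrowth_orthantPower (add_ceil_neg_nonneg α)).locallyIntegrable).iterate_lineDeriv
      (diag d) ⌈-α⌉₊
  rwa [add_sub_cancel_right] at homogeneous

theorem not_isHomogeneous_embed_homogeneousDist (hd : 1 ≤ d) (ρ : Mollifier d)
    (P : CutoffSystem d) (α β : ℝ) :
    ¬ (embed ρ P (homogeneousDist d α)).IsHomogeneous β := by
  have diag_pos : ∀ i, 0 < diag d i := fun i => one_pos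
  have diag_ne_zero : diag d ≠ 0 := fun h => by
    simpa [h] using diag_apply (⟨0, hd⟩ : Fin d)
  have hs := add_ceil_neg_nonneg α
  refine (hasPolynomialGrowth_orthantPower hs).not_isHomogeneous_embed_iterate_lineDeriv_regular
    (isPosHomogeneous_orthantPower _) (continuousAt_orthantPower hs diag_pos) ?_
    (ℓ := EuclideanSpace.proj (⟨0, hd⟩ : Fin d)) (diag_apply (⟨0, hd⟩ : Fin d))
    (fun x hx => nonneg_of_orthantPower_ne_zero hx _) ρ P _ β
  rw [orthantPower_of_pos diag_pos, Complex.ofReal_ne_zero]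
  exact (Real.rpow_pos_of_pos (norm_pos_iff.2 diag_ne_zero) _).ne'

lemma orthantPower_zero : orthantPower d 0 = fun x => ∏ i, heaviside (x i) :=
  funext fun x => by simp [orthantPower]

lemma homogeneousDist_zero : homogeneousDist d 0 = heavisideTensor d := by
  simp [homogeneousDist, heavisideTensor, regular, orthantPower_zero]

end OrthantPowers

section Oscillation

lemma GenNum.isAssociated_mk_iff {r : numModerate} {z : ℂ} :
    GenNum.IsAssociated (Ideal.Quotient.mk numNegligible r) z ↔
      Tendsto (r : Param → ℂ) toZero (𝓝 z) := by
  refine ⟨?_, fun h => ⟨r, rfl, h⟩⟩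
  rintro ⟨r', hr', hz⟩
  obtain ⟨C, hC⟩ := Ideal.Quotient.eq.1 hr' 1
  have tendsto_sub : Tendsto (fun ε => (r' : Param → ℂ) ε - (r : Param → ℂ) ε) toZero (𝓝 0) :=
    squeeze_zero_norm' (a := fun ε : Param => C * (ε : ℝ) ^ 1) hC
      (by simpa using tendsto_coe_toZero.const_mul C)
  simpa using hz.sub tendsto_sub

lemma frequently_toZero {p : Param → Prop} {x : ℕ → Param}
    (hx : Tendsto (fun n => (x n : ℝ)) atTop (𝓝 0)) (hp : ∀ n, p (x n)) : ∃ᶠ ε in toZero, p ε :=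
  (tendsto_comap_iff.2 hx).frequently (Frequently.of_forall hp)

lemma frequently_oscNet_eq_one : ∃ᶠ ε in toZero, oscNet ε = 1 := by
  have mem_param : ∀ n : ℕ, 1 / ((n : ℝ) + 1) ∈ Set.Ioc (0 : ℝ) 1 := fun n =>
    ⟨by positivity, div_le_one_of_le₀ (by linarith [n.cast_nonneg (α := ℝ)]) (by positivity)⟩
  exact frequently_toZero (x := fun n => ⟨_, mem_param n⟩) tendsto_one_div_add_atTop_nhds_zero_nat
    fun n => if_pos ⟨n + 1, by push_cast; rfl⟩

lemma frequently_oscNet_eq_zero : ∃ᶠ ε in toZero, oscNet ε = 0 := by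
  have mem_param : ∀ n : ℕ, 2 / (2 * (n : ℝ) + 3) ∈ Set.Ioc (0 : ℝ) 1 := fun n =>
    ⟨by positivity, div_le_one_of_le₀ (by linarith [n.cast_nonneg (α := ℝ)]) (by positivity)⟩
  have tendsto_zero : Tendsto (fun n : ℕ => 2 / (2 * (n : ℝ) + 3)) atTop (𝓝 0) :=
    ((tendsto_natCast_atTop_atTop.const_mul_atTop two_pos).atTop_add
      tendsto_const_nhds).const_div_atTop 2
  refine frequently_toZero (x := fun n => ⟨_, mem_param n⟩) tendsto_zero fun n => if_neg ?_
  rintro ⟨m, hm : 2 / (2 * (n : ℝ) + 3) = 1 / m⟩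
  have even_eq_odd : 2 * m = 2 * n + 3 := by
    rw [← inv_inj, inv_div, inv_div, div_one, div_eq_iff two_ne_zero] at hm
    exact_mod_cast (mul_comm _ _).trans hm.symm
  omega

lemma not_isAssociated_osc_mul {z : ℂ} (hz : z ≠ 0) (y : ℂ) :
    ¬ (osc * algebraMap ℂ GenNum z).IsAssociated y := by
  intro h
  have tendsto_osc : Tendsto (fun ε => oscNet ε * z) toZero (𝓝 y) :=
    GenNum.isAssociated_mk_iff.1 h
  have eq_of_frequently : ∀ {c : ℂ}, (∃ᶠ ε in toZero, oscNet ε = c) → y = c * z := fun hc =>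
    isClosed_singleton.mem_of_frequently_of_tendsto
      (hc.mono fun ε hε => Set.mem_singleton_iff.2 (by rw [hε])) tendsto_osc
  refine hz ?_
  rw [← one_mul z, ← eq_of_frequently frequently_oscNet_eq_one,
    eq_of_frequently frequently_oscNet_eq_zero, zero_mul]

namespace Gen

lemma not_isAssociated_const_osc_mul {u : Gen d} {φ : TestFun d ℂ} {z : ℂ} (hz : z ≠ 0)
    (hu : pair φ u = algebraMap ℂ GenNum z) (w : Dist d) : ¬ (const d osc * u).IsAssociated w := by
  intro hw
  refine not_isAssociated_osc_mul hz (w φ) ?_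
  rw [← hu, ← pair_const_mul]
  exact hw φ

lemma scale_const (c : ℝ) (a : GenNum) : scale c (const d a) = const d a := by
  obtain ⟨a, rfl⟩ := Ideal.Quotient.mk_surjective a
  rfl

lemma IsWeaklyHomogeneous.const_mul {u : Gen d} {α : ℝ} (hu : u.IsWeaklyHomogeneous α)
    (a : GenNum) : (const d a * u).IsWeaklyHomogeneous α := by
  intro c hc φ
  rw [map_mul, scale_const, pair_const_mul, hu c hc φ, ← mul_smul_comm, pair_const_mul]

lemma isWeaklyHomogeneous_const (a : GenNum) : (const d a).IsWeaklyHomogeneous 0 := by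
  intro c _ φ
  rw [scale_const, Real.rpow_zero, Complex.ofReal_one, one_smul]

lemma pair_one (φ : TestFun d ℂ) : pair φ (1 : Gen d) = algebraMap ℂ GenNum (∫ x, φ x) := by
  refine congrArg (Ideal.Quotient.mk numNegligible) (?_ :
    pairMod φ 1 = algebraMap ℂ numModerate (∫ x, φ x))
  exact Subtype.ext (funext fun _ => congrArg _ (funext fun x => one_mul (φ x)))

end Gen

lemma exists_testFun_integral_ne_zero (d : ℕ) : ∃ φ : TestFun d ℂ, ∫ x, φ x ≠ 0 := by
  let f : ContDiffBump (0 : Space d) := default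
  refine ⟨⟨fun x => (f x : ℂ), Complex.ofRealCLM.contDiff.comp f.contDiff,
    f.hasCompactSupport.comp_left Complex.ofReal_zero, fun _ _ => trivial⟩, ?_⟩
  change ∫ x, (f x : ℂ) ≠ 0
  rw [integral_complex_ofReal, Complex.ofReal_ne_zero]
  exact f.integral_pos.ne'

theorem Gen.not_isAssociated_const_osc (w : Dist d) : ¬ (Gen.const d osc).IsAssociated w := by
  obtain ⟨φ, hφ⟩ := exists_testFun_integral_ne_zero d
  simpa using Gen.not_isAssociated_const_osc_mul hφ (Gen.pair_one φ) w

lemma embed_zero (ρ : Mollifier d) (P : CutoffSystem d) : embed ρ P 0 = 0 := by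
  refine (congrArg (Ideal.Quotient.mk (negligible d)) (Subtype.ext ?_)).trans (map_zero _)
  funext ε x
  simp [embedNet, cutConv]

theorem Gen.not_isAssociated_const_osc_mul_embed (ρ : Mollifier d) (P : CutoffSystem d)
    {w : Dist d} (hw : embed ρ P w ≠ 0) (w' : Dist d) :
    ¬ (Gen.const d osc * embed ρ P w).IsAssociated w' := by
  obtain ⟨φ, hφ⟩ : ∃ φ, w φ ≠ 0 := by
    contrapose! hw
    rw [show w = 0 from ContinuousLinearMap.ext hw, embed_zero]
  exact Gen.not_isAssociated_const_osc_mul hφ (Gen.pair_embed ρ P w φ) w'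

lemma Gen.isHomogeneous_zero (β : ℝ) : (0 : Gen d).IsHomogeneous β := by
  intro c _
  rw [map_zero, smul_zero]

end Oscillation

end Colombeau

end

theorem mainTheorem8 (d : ℕ) (hd : 1 ≤ d) (ρ : Colombeau.Mollifier d)
    (P : Colombeau.CutoffSystem d) :
    (∀ α : ℝ, ∃ w : Colombeau.Dist d, w.IsHomogeneous α ∧
        (Colombeau.embed ρ P w).IsWeaklyHomogeneous α ∧
        ∀ β : ℝ, ¬ (Colombeau.embed ρ P w).IsHomogeneous β) ∧
    ((Colombeau.heavisideTensor d).IsHomogeneous 0 ∧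
        (Colombeau.embed ρ P (Colombeau.heavisideTensor d)).IsWeaklyHomogeneous 0 ∧
        ∀ β : ℝ, ¬ (Colombeau.embed ρ P (Colombeau.heavisideTensor d)).IsHomogeneous β) ∧
    (∀ α : ℝ, ∃ u : Colombeau.Gen d, u.IsWeaklyHomogeneous α ∧
        ¬ ∃ w : Colombeau.Dist d, u.IsAssociated w) ∧
    ((Colombeau.Gen.const d Colombeau.osc).IsWeaklyHomogeneous 0 ∧
        ¬ ∃ w : Colombeau.Dist d, (Colombeau.Gen.const d Colombeau.osc).IsAssociated w) := by
  open Colombeau in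
  have example_of_degree (α : ℝ) : (homogeneousDist d α).IsHomogeneous α ∧
      (embed ρ P (homogeneousDist d α)).IsWeaklyHomogeneous α ∧
      ∀ β : ℝ, ¬ (embed ρ P (homogeneousDist d α)).IsHomogeneous β :=
    ⟨isHomogeneous_homogeneousDist α,
      (isHomogeneous_homogeneousDist α).isWeaklyHomogeneous_embed ρ P,
      not_isHomogeneous_embed_homogeneousDist hd ρ P α⟩
  refine ⟨fun α => ⟨_, example_of_degree α⟩, homogeneousDist_zero ▸ example_of_degree 0,
    fun α => ?_, Gen.isWeaklyHomogeneous_const osc, not_exists.2 Gen.not_isAssociated_const_osc⟩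
  obtain ⟨-, weaklyHomogeneous, not_homogeneous⟩ := example_of_degree α
  have embed_ne_zero : embed ρ P (homogeneousDist d α) ≠ 0 := fun h =>
    not_homogeneous 0 (h ▸ Gen.isHomogeneous_zero 0)
  exact ⟨Gen.const d osc * embed ρ P (homogeneousDist d α), weaklyHomogeneous.const_mul osc,
    not_exists.2 (Gen.not_isAssociated_const_osc_mul_embed ρ P embed_ne_zero)⟩
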